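/- Let $S,n\ge 1$ be integers, let $\mathrm{U}(S)$ be the group of complex unitary $S\times S$ matrices with Haar measure $dg$ of total mass one, and let $\mathrm{U}(1)=\{z\in\mathbb{C}:|z|=1\}$. For a continuous, conjugacy-invariant function $f:\mathrm{U}(S)\to\mathbb{C}$, the mean of $f$ is the unique continuous function $\langle f\rangle:\mathrm{U}(1)\to\mathbb{C}$ such that $$\int_{\mathrm{U}(S)} f(g)\,\psi(\det g)\,dg=\int_{\mathrm{U}(S)}\langle f\rangle(\det g)\,\psi(\det g)\,dg$$ for every continuous $\psi:\mathrm{U}(1)\to\mathbb{C}$. Let $f:\mathrm{U}(S)\to\mathbb{C}$ be given by $f(g)=|\mathrm{Tr}(g^n)|^2$. Then $f$ is continuous and conjugacy-invariant, its mean $\langle f\rangle$ exists and is unique, and for every $z\in\mathrm{U}(1)$ $$\langle f\rangle(z)=\int_{\mathrm{U}(S)} f(g)\,dg=\min\{n,S\}.$$ -/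

import Mathlib

open MeasureTheory

/-- The unitary group `U(S)` of complex `S × S` matrices `g` with `g * gᴴ = 1`, as a topological
group (with the topology of its matrix entries). -/
abbrev UGroup (S : ℕ) : Type := Matrix.unitaryGroup (Fin S) ℂ

namespace UGroup

/-- `U(S)` is compact. -/
instance instCompactSpace (S : ℕ) : CompactSpace (UGroup S) := by
  refine (isCompact_iff_compactSpace (s := (Matrix.unitaryGroup (Fin S) ℂ : Set (Matrix (Fin S) (Fin S) ℂ)))).mp ?_
  have hK : IsCompact (Set.univ.pi fun _ : Fin S => Set.univ.pi fun _ : Fin S =>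
      Metric.closedBall (0 : ℂ) 1) :=
    isCompact_univ_pi fun _ => isCompact_univ_pi fun _ => isCompact_closedBall 0 1
  refine IsCompact.of_isClosed_subset (X := Matrix (Fin S) (Fin S) ℂ) hK ?_ ?_
  · have h : ((Matrix.unitaryGroup (Fin S) ℂ : Set (Matrix (Fin S) (Fin S) ℂ))) =
        {A | A * star A = 1} := by
      ext A
      exact Matrix.mem_unitaryGroup_iff
    rw [h]
    exact isClosed_eq (by fun_prop) continuous_const
  · intro A hA i _ j _
    simpa using entry_norm_bound_of_unitary hA i j

/-- `U(S)` carries its Borel σ-algebra. -/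
noncomputable instance instMeasurableSpace (S : ℕ) : MeasurableSpace (UGroup S) := borel _

instance instBorelSpace (S : ℕ) : BorelSpace (UGroup S) := ⟨rfl⟩

/-- The Haar measure `dg` on `U(S)`, normalised to have total mass one. -/
noncomputable def haar (S : ℕ) : Measure (UGroup S) :=
  Measure.haarMeasure ⊤

/-- The Haar measure is a probability measure. -/
instance instIsProbabilityMeasure (S : ℕ) : IsProbabilityMeasure (haar S) :=
  ⟨by simpa [haar] using Measure.haarMeasure_self (K₀ := (⊤ : TopologicalSpace.PositiveCompacts (UGroup S)))⟩

/-- The determinant `det : U(S) → U(1)`, where `U(1)` is the unit circle in `ℂ`. -/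
noncomputable def det {S : ℕ} (g : UGroup S) : Circle :=
  ⟨Matrix.det (g : Matrix (Fin S) (Fin S) ℂ), by
    have h := (Unitary.mem_iff.mp (Matrix.det_of_mem_unitary g.2)).2
    rw [Complex.star_def, Complex.mul_conj, Complex.normSq_eq_norm_sq] at h
    have h2 : ‖Matrix.det (g : Matrix (Fin S) (Fin S) ℂ)‖ ^ 2 = 1 := by exact_mod_cast h
    have h3 : ‖Matrix.det (g : Matrix (Fin S) (Fin S) ℂ)‖ = 1 :=
      (pow_eq_one_iff_of_nonneg (norm_nonneg _) two_ne_zero).mp h2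
    simpa [Submonoid.unitSphere] using h3⟩

/-- `F : U(1) → ℂ` is a mean of `f : U(S) → ℂ`: it is continuous and
`∫ f(g) ψ(det g) dg = ∫ F(det g) ψ(det g) dg` for every continuous `ψ : U(1) → ℂ`. The mean `⟨f⟩`
of a continuous, conjugacy-invariant `f` is the unique such `F`. -/
def IsMean {S : ℕ} (f : UGroup S → ℂ) (F : Circle → ℂ) : Prop :=
  Continuous F ∧ ∀ ψ : Circle → ℂ, Continuous ψ →
    ∫ g, f g * ψ (det g) ∂haar S = ∫ g, F (det g) * ψ (det g) ∂haar S

/-- The function `f(g) = |Tr(gⁿ)|²` on `U(S)`, regarded as complex-valued. -/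
noncomputable def absTraceSq (S n : ℕ) (g : UGroup S) : ℂ :=
  ((‖Matrix.trace ((g : Matrix (Fin S) (Fin S) ℂ) ^ n)‖ ^ 2 : ℝ) : ℂ)

end UGroup

/-! For an eigenvalue alphabet, the power sum of degree `n` is the signed sum of the hook Schur
functions of degree `n`, and hooks with more than `S` rows vanish on `S × S` matrices. Each
remaining hook pairs to `±1` with the power sum, and there are `min n S` of them, which gives the
second moment. No character theory is used: everything is derived from `det (1 - y g)` and
integration by parts.

The matrix `hookMat a b g` has trace `(-1) ^ b * (a + b + 1)` times the Schur function of the hook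
with arm `a` and leg `b`. Three facts carry the argument. The traces with `a + b = m` add up to `(m
+ 1) * trace (g ^ (m + 1))` (`sum_antidiagonal_trace_hookMat`). The matrix is zero for `b ≥ S`,
since the adjugate of `1 - X g` has degree below `S` (`hookMat_eq_zero`). Its divergence along left
translations is `S + a - b` times its trace (`leftDiv_hookMat`).

Invariance of Haar measure turns the last fact into `loop_equation`, which trades the pairing of
traces for the trace of a pairing. There unitarity cancels powers of `g` against `star g`, leaving
moments of lower degree apart from top-degree terms that cancel, so an induction on the degree
evaluates all moments (`hookMoment_eq`).

The mean is constant because `f` is unchanged under `g ↦ z g` while `det g` is multiplied by `z ^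
S`: averaging over `z` decouples `f` from every function of the determinant
(`integral_mul_comp_det`). -/

namespace Matrix

/-! ### Generating series of `det (1 - y g) ^ (∓1)`, and hook matrices. -/

open Finset

variable {ι : Type*} [Fintype ι] [DecidableEq ι]

/-- The Faddeev–LeVerrier recursion with parameter `c`: the coefficients of `det (1 - y g) ^ (-c)`
and of `det (1 - y g) ^ (-c) • (1 - y g)⁻¹` as power series in `y`. -/
noncomputable def leverrier (c : ℂ) (g : Matrix ι ι ℂ) : ℕ → ℂ × Matrix ι ι ℂ
  | 0 => (1, 1)
  | a + 1 =>
    (c / (a + 1) * trace (g * (leverrier c g a).2),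
      (c / (a + 1) * trace (g * (leverrier c g a).2)) • (1 : Matrix ι ι ℂ)
        + g * (leverrier c g a).2)

/-- The coefficients of the power series `det (1 - y g) ^ (-c)`. -/
noncomputable def detCoeff (c : ℂ) (a : ℕ) (g : Matrix ι ι ℂ) : ℂ := (leverrier c g a).1

/-- The coefficients of the power series `det (1 - y g) ^ (-c) • (1 - y g)⁻¹`. -/
noncomputable def resCoeff (c : ℂ) (a : ℕ) (g : Matrix ι ι ℂ) : Matrix ι ι ℂ := (leverrier c g a).2

@[simp] lemma detCoeff_zero (c : ℂ) (g : Matrix ι ι ℂ) : detCoeff c 0 g = 1 := rfl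

@[simp] lemma resCoeff_zero (c : ℂ) (g : Matrix ι ι ℂ) : resCoeff c 0 g = 1 := rfl

lemma detCoeff_succ (c : ℂ) (a : ℕ) (g : Matrix ι ι ℂ) :
    detCoeff c (a + 1) g = c / (a + 1) * trace (g * resCoeff c a g) := rfl

lemma resCoeff_succ (c : ℂ) (a : ℕ) (g : Matrix ι ι ℂ) :
    resCoeff c (a + 1) g = detCoeff c (a + 1) g • (1 : Matrix ι ι ℂ) + g * resCoeff c a g := rfl

lemma succ_mul_detCoeff_succ (c : ℂ) (a : ℕ) (g : Matrix ι ι ℂ) :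
    ((a : ℂ) + 1) * detCoeff c (a + 1) g = c * trace (g * resCoeff c a g) := by
  have : (a : ℂ) + 1 ≠ 0 := Nat.cast_add_one_ne_zero a
  rw [detCoeff_succ]
  field_simp

lemma resCoeff_eq_sum (c : ℂ) (a : ℕ) (g : Matrix ι ι ℂ) :
    resCoeff c a g = ∑ i ∈ range (a + 1), detCoeff c (a - i) g • g ^ i := by
  induction a with
  | zero => simp
  | succ a ih =>
    rw [resCoeff_succ, sum_range_succ', ih, mul_sum, add_comm]
    simp [pow_succ']

lemma commute_resCoeff (c : ℂ) (a : ℕ) (g : Matrix ι ι ℂ) : Commute g (resCoeff c a g) := by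
  rw [resCoeff_eq_sum]
  exact Commute.sum_right _ _ _ fun i _ => ((Commute.refl g).pow_right i).smul_right _

lemma commute_resCoeff_resCoeff (c d : ℂ) (a b : ℕ) (g : Matrix ι ι ℂ) :
    Commute (resCoeff c a g) (resCoeff d b g) := by
  rw [resCoeff_eq_sum d]
  exact Commute.sum_right _ _ _ fun i _ => ((commute_resCoeff c a g).symm.pow_right i).smul_right _

/-- Coefficient form of differentiating `det (1 - y g) ^ (-c) • (1 - y g)⁻¹` in `y`: the factor
produced is `c * trace (g (1 - y g)⁻¹) + g (1 - y g)⁻¹`, expanded as a geometric series. -/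
lemma succ_smul_resCoeff_succ (c : ℂ) (a : ℕ) (g : Matrix ι ι ℂ) :
    ((a : ℂ) + 1) • resCoeff c (a + 1) g =
      ∑ i ∈ range (a + 1),
        ((c * trace (g ^ (i + 1))) • resCoeff c (a - i) g + g ^ (i + 1) * resCoeff c (a - i) g) := by
  induction a with
  | zero => simp [resCoeff_succ, detCoeff_succ]
  | succ a ih =>
    have h1 : ((a : ℂ) + 1 + 1) * detCoeff c (a + 1 + 1) g
        = ∑ i ∈ range (a + 1 + 1), c * trace (g ^ (i + 1)) * detCoeff c (a + 1 - i) g := by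
      have := succ_mul_detCoeff_succ c (a + 1) g
      push_cast at this
      rw [this, resCoeff_eq_sum, mul_sum, trace_sum, mul_sum]
      refine sum_congr rfl fun i _ => ?_
      rw [mul_smul_comm, trace_smul, ← pow_succ', smul_eq_mul]
      ring
    have h2 : ∀ i ∈ range (a + 1), (c * trace (g ^ (i + 1))) • resCoeff c (a + 1 - i) g
        = (c * trace (g ^ (i + 1)) * detCoeff c (a + 1 - i) g) • (1 : Matrix ι ι ℂ)
          + g * ((c * trace (g ^ (i + 1))) • resCoeff c (a - i) g) := by
      intro i hi
      have : a + 1 - i = (a - i) + 1 := by have := mem_range.1 hi; omega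
      rw [this, resCoeff_succ, smul_add, smul_smul, mul_smul_comm]
    rw [sum_add_distrib, sum_range_succ, sum_congr rfl h2, sum_add_distrib, ← sum_smul,
      resCoeff_succ, smul_add, smul_smul]
    push_cast
    rw [h1, sum_range_succ _ (a + 1), sum_range_succ' (fun i => g ^ (i + 1) * resCoeff c (a + 1 - i) g)]
    have h3 : ((a : ℂ) + 1 + 1) • (g * resCoeff c (a + 1) g)
        = g * (((a : ℂ) + 1) • resCoeff c (a + 1) g) + g * resCoeff c (a + 1) g := by
      rw [add_smul, one_smul, mul_smul_comm]
    rw [h3, ih, sum_add_distrib, mul_add, mul_sum, mul_sum, add_smul]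
    have h4 : ∀ i ∈ range (a + 1), g ^ (i + 1 + 1) * resCoeff c (a + 1 - (i + 1)) g
        = g * (g ^ (i + 1) * resCoeff c (a - i) g) := by
      intro i _
      rw [Nat.add_sub_add_right, ← mul_assoc, ← pow_succ']
    rw [sum_congr rfl h4]
    simp
    abel

/-- The matrix `g K_a C_b`, whose trace is a multiple of a hook Schur function of `g`. -/
noncomputable def hookMat (a b : ℕ) (g : Matrix ι ι ℂ) : Matrix ι ι ℂ :=
  g * resCoeff 1 a g * resCoeff (-1) b g

lemma hookMat_zero_right (a : ℕ) (g : Matrix ι ι ℂ) : hookMat a 0 g = g * resCoeff 1 a g := by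
  simp [hookMat]

lemma hookMat_zero_left (b : ℕ) (g : Matrix ι ι ℂ) : hookMat 0 b g = g * resCoeff (-1) b g := by
  simp [hookMat]

/-- Expand `resCoeff 1 (a + 1) g * resCoeff (-1) (b + 1) g` by the recursion of either factor and
compare. After taking traces this is the Pieri rule for a row times a column. -/
lemma hookMat_succ_right (a b : ℕ) (g : Matrix ι ι ℂ) :
    hookMat a (b + 1) g = hookMat (a + 1) b g + detCoeff (-1) (b + 1) g • resCoeff 1 (a + 1) g
      - detCoeff 1 (a + 1) g • resCoeff (-1) (b + 1) g := by
  have h1 : resCoeff 1 (a + 1) g * resCoeff (-1) (b + 1) g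
      = detCoeff (-1) (b + 1) g • resCoeff 1 (a + 1) g + hookMat (a + 1) b g := by
    rw [resCoeff_succ (-1) b, mul_add, mul_smul_comm, mul_one, ← mul_assoc,
      ← (commute_resCoeff 1 (a + 1) g).eq, hookMat]
  have h2 : resCoeff 1 (a + 1) g * resCoeff (-1) (b + 1) g
      = detCoeff 1 (a + 1) g • resCoeff (-1) (b + 1) g + hookMat a (b + 1) g := by
    rw [resCoeff_succ 1 a, add_mul, smul_mul_assoc, one_mul, hookMat]
  rw [add_comm (hookMat (a + 1) b g), ← h1, h2]
  abel

lemma trace_hookMat_zero_right (a : ℕ) (g : Matrix ι ι ℂ) :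
    trace (hookMat a 0 g) = ((a : ℂ) + 1) * detCoeff 1 (a + 1) g := by
  rw [hookMat_zero_right, succ_mul_detCoeff_succ, one_mul]

lemma trace_hookMat_zero_left (b : ℕ) (g : Matrix ι ι ℂ) :
    trace (hookMat 0 b g) = -(((b : ℂ) + 1) * detCoeff (-1) (b + 1) g) := by
  rw [hookMat_zero_left, succ_mul_detCoeff_succ, neg_one_mul, neg_neg]

lemma trace_resCoeff {c : ℂ} (hc : c * c = 1) (a : ℕ) (g : Matrix ι ι ℂ) :
    trace (resCoeff c a g) = (Fintype.card ι + c * a) * detCoeff c a g := by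
  cases a with
  | zero => simp
  | succ a =>
    have h := succ_mul_detCoeff_succ c a g
    rw [resCoeff_succ, trace_add, trace_smul, trace_one, smul_eq_mul]
    push_cast
    linear_combination (-c) * h - trace (g * resCoeff c a g) * hc

lemma trace_hookMat_succ_right (a b : ℕ) (g : Matrix ι ι ℂ) :
    trace (hookMat a (b + 1) g) = trace (hookMat (a + 1) b g)
      + ((a : ℂ) + b + 2) * (detCoeff 1 (a + 1) g * detCoeff (-1) (b + 1) g) := by
  rw [hookMat_succ_right, trace_sub, trace_add, trace_smul, trace_smul,
    trace_resCoeff (by norm_num), trace_resCoeff (by norm_num)]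
  simp only [smul_eq_mul]
  push_cast
  ring

/-- Both sums are coefficients of `(1 - y g)⁻¹`, but that is not yet known here; the difference
telescopes through `hookMat_succ_right`. -/
lemma sum_antidiagonal_smul_resCoeff (m : ℕ) (g : Matrix ι ι ℂ) :
    ∑ x ∈ antidiagonal m, detCoeff (-1) x.2 g • resCoeff 1 x.1 g
      = ∑ x ∈ antidiagonal m, detCoeff 1 x.1 g • resCoeff (-1) x.2 g := by
  cases m with
  | zero => simp
  | succ m =>
    rw [Nat.sum_antidiagonal_succ, Nat.sum_antidiagonal_succ]
    cases m with
    | zero =>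
      simp [resCoeff_succ]
      abel
    | succ m =>
      rw [Nat.sum_antidiagonal_succ', Nat.sum_antidiagonal_succ']
      have h : ∀ x : ℕ × ℕ, detCoeff (-1) (x.2 + 1) g • resCoeff 1 (x.1 + 1) g
          = detCoeff 1 (x.1 + 1) g • resCoeff (-1) (x.2 + 1) g
            + (hookMat x.1 (x.2 + 1) g - hookMat (x.1 + 1) x.2 g) := by
        intro x
        rw [hookMat_succ_right]
        abel
      have h2 := Nat.sum_antidiagonal_succ (n := m) (f := fun x => hookMat x.1 x.2 g)
      have h3 := Nat.sum_antidiagonal_succ' (n := m) (f := fun x => hookMat x.1 x.2 g)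
      simp only [h, sum_add_distrib, sum_sub_distrib]
      simp only [detCoeff_zero, one_smul, resCoeff_zero, resCoeff_succ 1 (m + 1),
        resCoeff_succ (-1) (m + 1), ← hookMat_zero_left, ← hookMat_zero_right] at *
      rw [h2] at h3
      rw [add_comm] at h3
      rw [← sub_eq_sub_iff_add_eq_add] at h3
      have h4 := congrArg Neg.neg h3
      rw [neg_sub, neg_sub] at h4
      rw [h4]
      abel

/-- This is `det (1 - y g)⁻¹ * det (1 - y g) = 1` in positive degree. Multiplying by the degree and
splitting it as `x.1 + x.2` turns the sum into a difference of two traces, equal by the preceding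
lemma. -/
lemma sum_antidiagonal_detCoeff (m : ℕ) (g : Matrix ι ι ℂ) :
    ∑ x ∈ antidiagonal (m + 1), detCoeff 1 x.1 g * detCoeff (-1) x.2 g = 0 := by
  have hm : (m : ℂ) + 1 ≠ 0 := Nat.cast_add_one_ne_zero m
  refine (mul_eq_zero.1 ?_).resolve_left hm
  have h1 : ∑ x ∈ antidiagonal (m + 1), (x.1 : ℂ) * (detCoeff 1 x.1 g * detCoeff (-1) x.2 g)
      = trace (g * ∑ x ∈ antidiagonal m, detCoeff (-1) x.2 g • resCoeff 1 x.1 g) := by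
    rw [Nat.sum_antidiagonal_succ, mul_sum, trace_sum]
    simp only [Nat.cast_zero, zero_mul, zero_add]
    refine sum_congr rfl fun x _ => ?_
    have := succ_mul_detCoeff_succ 1 x.1 g
    rw [mul_smul_comm, trace_smul, smul_eq_mul]
    push_cast
    linear_combination detCoeff (-1) x.2 g * this
  have h2 : ∑ x ∈ antidiagonal (m + 1), (x.2 : ℂ) * (detCoeff 1 x.1 g * detCoeff (-1) x.2 g)
      = -trace (g * ∑ x ∈ antidiagonal m, detCoeff 1 x.1 g • resCoeff (-1) x.2 g) := by
    rw [Nat.sum_antidiagonal_succ', mul_sum, trace_sum, ← sum_neg_distrib]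
    simp only [Nat.cast_zero, zero_mul, zero_add]
    refine sum_congr rfl fun x _ => ?_
    have := succ_mul_detCoeff_succ (-1) x.2 g
    rw [mul_smul_comm, trace_smul, smul_eq_mul]
    push_cast
    linear_combination detCoeff 1 x.1 g * this
  have h3 : ((m : ℂ) + 1) * ∑ x ∈ antidiagonal (m + 1), detCoeff 1 x.1 g * detCoeff (-1) x.2 g
      = ∑ x ∈ antidiagonal (m + 1), (x.1 : ℂ) * (detCoeff 1 x.1 g * detCoeff (-1) x.2 g)
        + ∑ x ∈ antidiagonal (m + 1), (x.2 : ℂ) * (detCoeff 1 x.1 g * detCoeff (-1) x.2 g) := by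
    rw [← sum_add_distrib, mul_sum]
    refine sum_congr rfl fun x hx => ?_
    have : ((x.1 : ℂ) + x.2) = m + 1 := by exact_mod_cast mem_antidiagonal.1 hx
    rw [← this]
    ring
  rw [h3, h1, h2, sum_antidiagonal_smul_resCoeff]
  ring

lemma sum_antidiagonal_detCoeff_smul_resCoeff (m : ℕ) (g : Matrix ι ι ℂ) :
    ∑ x ∈ antidiagonal m, detCoeff (-1) x.2 g • resCoeff 1 x.1 g = g ^ m := by
  induction m with
  | zero => simp
  | succ m ih =>
    have h := sum_antidiagonal_detCoeff m g
    rw [Nat.sum_antidiagonal_succ] at h ⊢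
    simp only [resCoeff_succ, smul_add, sum_add_distrib, smul_smul, ← sum_smul, mul_comm (detCoeff (-1) _ g),
      resCoeff_zero, ← mul_smul_comm, ← mul_sum, ih]
    rw [← add_assoc, ← add_smul, pow_succ']
    simp only [detCoeff_zero, one_mul] at h ⊢
    rw [h]
    simp

/-- The determinants cancel in the product of the two series, leaving `(1 - y g)⁻¹` squared. -/
lemma sum_antidiagonal_resCoeff_mul_resCoeff (m : ℕ) (g : Matrix ι ι ℂ) :
    ∑ x ∈ antidiagonal m, resCoeff 1 x.1 g * resCoeff (-1) x.2 g = ((m : ℂ) + 1) • g ^ m := by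
  induction m with
  | zero => simp
  | succ m ih =>
    have h := sum_antidiagonal_detCoeff_smul_resCoeff (m + 1) g
    rw [Nat.sum_antidiagonal_succ'] at h ⊢
    have h2 : ∀ x : ℕ × ℕ, resCoeff 1 x.1 g * resCoeff (-1) (x.2 + 1) g
        = detCoeff (-1) (x.2 + 1) g • resCoeff 1 x.1 g
          + g * (resCoeff 1 x.1 g * resCoeff (-1) x.2 g) := by
      intro x
      rw [resCoeff_succ (-1), mul_add, mul_smul_comm, mul_one, ← mul_assoc,
        ← (commute_resCoeff 1 x.1 g).eq, mul_assoc]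
    simp only [h2, sum_add_distrib, ← mul_sum, ih]
    simp only [detCoeff_zero, one_smul, resCoeff_zero, mul_one] at h ⊢
    rw [← add_assoc, h, mul_smul_comm, ← pow_succ']
    push_cast
    module

/-- The power sum `tr (g ^ (m + 1))` as a sum of traces of hook matrices. -/
lemma sum_antidiagonal_trace_hookMat (m : ℕ) (g : Matrix ι ι ℂ) :
    ∑ x ∈ antidiagonal m, trace (hookMat x.1 x.2 g) = ((m : ℂ) + 1) * trace (g ^ (m + 1)) := by
  simp only [hookMat, mul_assoc, ← trace_sum, ← mul_sum, sum_antidiagonal_resCoeff_mul_resCoeff]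
  rw [mul_smul_comm, trace_smul, smul_eq_mul, ← pow_succ']

end Matrix

/-! ### Vanishing of long hooks through the adjugate of `1 - X g`. -/

namespace Matrix

open Finset Polynomial

/-- Jacobi's formula for the derivative of the determinant of a matrix of polynomials. -/
lemma derivative_det_eq_trace {ι R : Type*} [Fintype ι] [DecidableEq ι] [CommRing R]
    (M : Matrix ι ι R[X]) :
    derivative M.det = trace (adjugate M * M.map derivative) := by
  have h1 : derivative M.det = ∑ j, (M.updateCol j fun i => derivative (M i j)).det := by
    simp only [det_apply, derivative_sum, Units.smul_def, zsmul_eq_mul, derivative_intCast_mul]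
    rw [sum_comm]
    refine sum_congr rfl fun σ _ => ?_
    rw [derivative_prod_finset, ← mul_sum]
    congr 1
    refine sum_congr rfl fun i _ => ?_
    rw [← mul_prod_erase univ _ (mem_univ i), mul_comm]
    congr 1
    · simp
    · refine prod_congr rfl fun j hj => ?_
      rw [updateCol_ne (ne_of_mem_erase hj)]
  rw [h1, trace]
  refine sum_congr rfl fun j _ => ?_
  rw [diag_apply, ← cramer_apply, cramer_eq_adjugate_mulVec]
  rfl

variable {S : ℕ}

/-- The matrix `1 - X g` over the polynomial ring. -/
noncomputable def oneSubXMul (g : Matrix (Fin S) (Fin S) ℂ) : Matrix (Fin S) (Fin S) ℂ[X] :=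
  1 - (X : ℂ[X]) • g.map C

/-- The coefficients of the adjugate of `1 - X g`. -/
noncomputable def adjCoeff (b : ℕ) (g : Matrix (Fin S) (Fin S) ℂ) : Matrix (Fin S) (Fin S) ℂ :=
  (adjugate (oneSubXMul g)).map fun p => p.coeff b

/-- Entries of the adjugate are signed minors of size `S - 1` whose entries are affine in `X`, hence
have degree at most `S - 1`. -/
lemma adjCoeff_eq_zero (hS : 1 ≤ S) {b : ℕ} (hb : S ≤ b) (g : Matrix (Fin S) (Fin S) ℂ) :
    adjCoeff b g = 0 := by
  obtain ⟨s, rfl⟩ : ∃ s, S = s + 1 := ⟨S - 1, by omega⟩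
  ext i j
  rw [adjCoeff, map_apply, adjugate_fin_succ_eq_det_submatrix, zero_apply]
  have h : (oneSubXMul g).submatrix j.succAbove i.succAbove
      = (X : ℂ[X]) • ((-g).submatrix j.succAbove i.succAbove).map C
        + ((1 : Matrix _ _ ℂ).submatrix j.succAbove i.succAbove).map C := by
    ext k l
    simp only [oneSubXMul, submatrix_apply, sub_apply, smul_apply, map_apply, add_apply, neg_apply,
      one_apply, smul_eq_mul, map_neg, apply_ite C, map_one, map_zero]
    rw [mul_neg, sub_eq_neg_add]
  rw [h]
  have hd := natDegree_det_X_add_C_le ((-g).submatrix j.succAbove i.succAbove)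
    ((1 : Matrix _ _ ℂ).submatrix j.succAbove i.succAbove)
  rw [Fintype.card_fin] at hd
  refine coeff_eq_zero_of_natDegree_lt ?_
  have : ((-1 : ℂ[X]) ^ ((j : ℕ) + (i : ℕ))) = C ((-1) ^ ((j : ℕ) + (i : ℕ))) := by simp
  rw [this]
  exact (natDegree_C_mul_le _ _).trans_lt (by omega)

lemma adjCoeff_succ (b : ℕ) (g : Matrix (Fin S) (Fin S) ℂ) :
    adjCoeff (b + 1) g = (oneSubXMul g).det.coeff (b + 1) • (1 : Matrix (Fin S) (Fin S) ℂ)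
      + g * adjCoeff b g := by
  have h := mul_adjugate (oneSubXMul g)
  rw [oneSubXMul, sub_mul, one_mul, smul_mul_assoc, ← oneSubXMul, sub_eq_iff_eq_add] at h
  ext i j
  rw [adjCoeff, map_apply, h]
  simp only [add_apply, smul_apply, smul_eq_mul, coeff_add, coeff_X_mul, one_apply, mul_apply,
    finsetSum_coeff, map_apply, coeff_C_mul, adjCoeff]
  congr 1
  split_ifs <;> simp

lemma adjCoeff_zero (g : Matrix (Fin S) (Fin S) ℂ) : adjCoeff 0 g = 1 := by
  have h := mul_adjugate (oneSubXMul g)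
  have h0 : (oneSubXMul g).det.coeff 0 = 1 := by
    rw [coeff_zero_eq_eval_zero, eval_det]
    convert det_one (R := ℂ) (n := Fin S)
    ext i j
    simp [oneSubXMul, one_apply]
  rw [oneSubXMul, sub_mul, one_mul, smul_mul_assoc, ← oneSubXMul, sub_eq_iff_eq_add] at h
  ext i j
  rw [adjCoeff, map_apply, h]
  simp only [add_apply, smul_apply, smul_eq_mul, coeff_add, one_apply, mul_ite, mul_one, mul_zero,
    mul_coeff_zero, coeff_X_zero, zero_mul, add_zero]
  split_ifs <;> simp [h0]

lemma succ_mul_coeff_det_oneSubXMul (b : ℕ) (g : Matrix (Fin S) (Fin S) ℂ) :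
    ((b : ℂ) + 1) * (oneSubXMul g).det.coeff (b + 1) = -trace (g * adjCoeff b g) := by
  have h := congrArg (fun p => coeff p b) (derivative_det_eq_trace (oneSubXMul g))
  have hd : (oneSubXMul g).map derivative = -g.map C := by
    ext i j
    simp [oneSubXMul, one_apply, apply_ite derivative]
  simp only [coeff_derivative, hd] at h
  rw [mul_comm, h, trace_mul_comm g, mul_neg, trace_neg, coeff_neg]
  simp [trace, mul_apply, adjCoeff]

/-- The two sequences obey the same recursion: `(1 - X g) * adjugate = det` gives the matrix part,
and Jacobi's formula the scalar part. -/
lemma resCoeff_neg_one_eq_adjCoeff (b : ℕ) (g : Matrix (Fin S) (Fin S) ℂ) :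
    resCoeff (-1) b g = adjCoeff b g := by
  induction b with
  | zero => rw [resCoeff_zero, adjCoeff_zero]
  | succ b ih =>
    rw [resCoeff_succ, adjCoeff_succ, ← ih]
    congr 2
    have hb : (b : ℂ) + 1 ≠ 0 := Nat.cast_add_one_ne_zero b
    refine mul_left_cancel₀ hb ?_
    rw [succ_mul_coeff_det_oneSubXMul, succ_mul_detCoeff_succ, neg_one_mul, ih]

/-- Cayley–Hamilton in the form of the Faddeev–LeVerrier recursion: it stops at the size of the
matrix. -/
lemma resCoeff_neg_one_eq_zero (hS : 1 ≤ S) {b : ℕ} (hb : S ≤ b) (g : Matrix (Fin S) (Fin S) ℂ) :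
    resCoeff (-1) b g = 0 := by
  rw [resCoeff_neg_one_eq_adjCoeff, adjCoeff_eq_zero hS hb]

lemma hookMat_eq_zero (hS : 1 ≤ S) (a : ℕ) {b : ℕ} (hb : S ≤ b) (g : Matrix (Fin S) (Fin S) ℂ) :
    hookMat a b g = 0 := by
  rw [hookMat, resCoeff_neg_one_eq_zero hS hb, mul_zero]

end Matrix

/-! ### Derivatives and the divergence of hook matrices. -/

namespace Matrix

open Finset
open scoped Matrix.Norms.Operator

section Calculus

variable {ι : Type*} [Fintype ι]

/-- The trace as a continuous linear functional. -/
noncomputable def traceL : Matrix ι ι ℂ →L[ℂ] ℂ :=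
  LinearMap.toContinuousLinearMap (traceLinearMap ι ℂ ℂ)

/-- An entry as a continuous linear functional. -/
noncomputable def entryL (i j : ι) : Matrix ι ι ℂ →L[ℂ] ℂ :=
  LinearMap.toContinuousLinearMap (entryLinearMap ℂ ℂ i j)

lemma contDiff_trace {f : Matrix ι ι ℂ → Matrix ι ι ℂ} (hf : ContDiff ℂ 1 f) :
    ContDiff ℂ 1 fun g => trace (f g) :=
  (traceL (ι := ι)).contDiff.comp hf

lemma contDiff_entry {f : Matrix ι ι ℂ → Matrix ι ι ℂ} (hf : ContDiff ℂ 1 f) (i j : ι) :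
    ContDiff ℂ 1 fun g => f g i j :=
  (entryL i j).contDiff.comp hf

variable [DecidableEq ι]

lemma fderiv_trace_apply {f : Matrix ι ι ℂ → Matrix ι ι ℂ} {g : Matrix ι ι ℂ}
    (hf : DifferentiableAt ℂ f g) (Y : Matrix ι ι ℂ) :
    fderiv ℂ (fun g => trace (f g)) g Y = trace (fderiv ℂ f g Y) := by
  have := ((traceL (ι := ι)).hasFDerivAt.comp g hf.hasFDerivAt).fderiv
  exact congrArg (fun L => L Y) this

lemma fderiv_entry_apply {f : Matrix ι ι ℂ → Matrix ι ι ℂ} {g : Matrix ι ι ℂ}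
    (hf : DifferentiableAt ℂ f g) (i j : ι) (Y : Matrix ι ι ℂ) :
    fderiv ℂ (fun g => f g i j) g Y = fderiv ℂ f g Y i j := by
  have := ((entryL i j).hasFDerivAt.comp g hf.hasFDerivAt).fderiv
  exact congrArg (fun L => L Y) this

lemma contDiff_resCoeff (c : ℂ) (a : ℕ) :
    ContDiff ℂ 1 (resCoeff c a : Matrix ι ι ℂ → Matrix ι ι ℂ) := by
  induction a with
  | zero => exact contDiff_const
  | succ a ih =>
    have h : ContDiff ℂ 1 fun g : Matrix ι ι ℂ => g * resCoeff c a g := contDiff_id.mul ih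
    exact ((contDiff_const.mul (contDiff_trace h)).smul contDiff_const).add h

lemma contDiff_detCoeff (c : ℂ) (a : ℕ) :
    ContDiff ℂ 1 (detCoeff c a : Matrix ι ι ℂ → ℂ) := by
  cases a with
  | zero => exact contDiff_const
  | succ a => exact contDiff_const.mul (contDiff_trace (contDiff_id.mul (contDiff_resCoeff c a)))

lemma contDiff_hookMat (a b : ℕ) :
    ContDiff ℂ 1 (hookMat a b : Matrix ι ι ℂ → Matrix ι ι ℂ) :=
  (contDiff_id.mul (contDiff_resCoeff 1 a)).mul (contDiff_resCoeff (-1) b)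

lemma differentiableAt_resCoeff (c : ℂ) (a : ℕ) (g : Matrix ι ι ℂ) :
    DifferentiableAt ℂ (resCoeff c a) g :=
  (contDiff_resCoeff c a).differentiable one_ne_zero g

lemma differentiableAt_detCoeff (c : ℂ) (a : ℕ) (g : Matrix ι ι ℂ) :
    DifferentiableAt ℂ (detCoeff c a) g :=
  (contDiff_detCoeff c a).differentiable one_ne_zero g

lemma differentiableAt_hookMat (a b : ℕ) (g : Matrix ι ι ℂ) :
    DifferentiableAt ℂ (hookMat a b) g :=
  (contDiff_hookMat a b).differentiable one_ne_zero g

lemma fderiv_id_mul_apply {f : Matrix ι ι ℂ → Matrix ι ι ℂ} {g : Matrix ι ι ℂ}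
    (hf : DifferentiableAt ℂ f g) (Y : Matrix ι ι ℂ) :
    fderiv ℂ (fun g => g * f g) g Y = Y * f g + g * fderiv ℂ f g Y := by
  have := ((hasFDerivAt_id (𝕜 := ℂ) g).mul' hf.hasFDerivAt).fderiv
  exact (congrArg (fun L => L Y) this).trans (add_comm _ _)

lemma fderiv_matrix_smul_apply {f : Matrix ι ι ℂ → ℂ} {V : Matrix ι ι ℂ → Matrix ι ι ℂ}
    {g : Matrix ι ι ℂ} (hf : DifferentiableAt ℂ f g) (hV : DifferentiableAt ℂ V g)
    (Y : Matrix ι ι ℂ) :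
    fderiv ℂ (fun g => f g • V g) g Y = f g • fderiv ℂ V g Y + fderiv ℂ f g Y • V g := by
  have := (hf.hasFDerivAt.smul hV.hasFDerivAt).fderiv
  exact congrArg (fun L => L Y) this

lemma fderiv_matrix_add_apply {V W : Matrix ι ι ℂ → Matrix ι ι ℂ} {g : Matrix ι ι ℂ}
    (hV : DifferentiableAt ℂ V g) (hW : DifferentiableAt ℂ W g) (Y : Matrix ι ι ℂ) :
    fderiv ℂ (fun g => V g + W g) g Y = fderiv ℂ V g Y + fderiv ℂ W g Y :=
  congrArg (fun L => L Y) (hV.hasFDerivAt.add hW.hasFDerivAt).fderiv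

lemma fderiv_matrix_sub_apply {V W : Matrix ι ι ℂ → Matrix ι ι ℂ} {g : Matrix ι ι ℂ}
    (hV : DifferentiableAt ℂ V g) (hW : DifferentiableAt ℂ W g) (Y : Matrix ι ι ℂ) :
    fderiv ℂ (fun g => V g - W g) g Y = fderiv ℂ V g Y - fderiv ℂ W g Y :=
  congrArg (fun L => L Y) (hV.hasFDerivAt.sub hW.hasFDerivAt).fderiv

@[simp] lemma fderiv_resCoeff_zero_apply (c : ℂ) (g Y : Matrix ι ι ℂ) :
    fderiv ℂ (resCoeff c 0) g Y = 0 :=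
  congrArg (fun L => L Y) (hasFDerivAt_const (𝕜 := ℂ) (1 : Matrix ι ι ℂ) g).fderiv

lemma differentiableAt_id_mul_resCoeff (c : ℂ) (a : ℕ) (g : Matrix ι ι ℂ) :
    DifferentiableAt ℂ (fun g : Matrix ι ι ℂ => g * resCoeff c a g) g :=
  differentiableAt_id.mul (differentiableAt_resCoeff c a g)

lemma fderiv_resCoeff_succ_apply (c : ℂ) (a : ℕ) (g Y : Matrix ι ι ℂ) :
    fderiv ℂ (resCoeff c (a + 1)) g Y = fderiv ℂ (detCoeff c (a + 1)) g Y • (1 : Matrix ι ι ℂ)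
      + (Y * resCoeff c a g + g * fderiv ℂ (resCoeff c a) g Y) := by
  have h1 := differentiableAt_resCoeff c a g
  have h2 := differentiableAt_detCoeff c (a + 1) g
  have h3 : resCoeff c (a + 1) = fun g : Matrix ι ι ℂ =>
      detCoeff c (a + 1) g • resCoeff c 0 g + g * resCoeff c a g := rfl
  have h4 := differentiableAt_resCoeff c 0 g
  have h5 : DifferentiableAt ℂ (fun g => detCoeff c (a + 1) g • resCoeff c 0 g) g := h2.smul h4
  rw [h3, fderiv_matrix_add_apply h5 (differentiableAt_id_mul_resCoeff c a g),
    fderiv_matrix_smul_apply h2 h4, fderiv_id_mul_apply h1, fderiv_resCoeff_zero_apply, smul_zero,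
    zero_add, resCoeff_zero]

lemma succ_mul_fderiv_detCoeff_succ_apply (c : ℂ) (a : ℕ) (g Y : Matrix ι ι ℂ) :
    ((a : ℂ) + 1) * fderiv ℂ (detCoeff c (a + 1)) g Y
      = c * trace (Y * resCoeff c a g + g * fderiv ℂ (resCoeff c a) g Y) := by
  have h1 := differentiableAt_resCoeff c a g
  have ha : (a : ℂ) + 1 ≠ 0 := Nat.cast_add_one_ne_zero a
  have h4 : DifferentiableAt ℂ (fun g : Matrix ι ι ℂ => trace (g * resCoeff c a g)) g :=
    (contDiff_trace (contDiff_id.mul (contDiff_resCoeff c a))).differentiable one_ne_zero g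
  have h5 : fderiv ℂ (detCoeff c (a + 1)) g Y
      = c / (a + 1) * fderiv ℂ (fun g : Matrix ι ι ℂ => trace (g * resCoeff c a g)) g Y :=
    congrArg (fun L => L Y) (h4.hasFDerivAt.const_mul (c / (a + 1))).fderiv
  rw [h5, fderiv_trace_apply (differentiableAt_id_mul_resCoeff c a g), fderiv_id_mul_apply h1]
  field_simp

/-- Unrolling the recursion moves one factor `g` to the front at each step, so `j` must be free.
What remains involves derivatives of `detCoeff` only, as the strong induction below requires. -/
lemma trace_pow_mul_fderiv_resCoeff (c : ℂ) (a j : ℕ) (g Y : Matrix ι ι ℂ) :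
    trace (g ^ j * fderiv ℂ (resCoeff c a) g Y)
      = ∑ i ∈ range a, (trace (g ^ (j + i)) * fderiv ℂ (detCoeff c (a - i)) g Y
          + trace (g ^ (j + i) * Y * resCoeff c (a - 1 - i) g)) := by
  induction a generalizing j with
  | zero => simp
  | succ a ih =>
    rw [fderiv_resCoeff_succ_apply, sum_range_succ', mul_add, mul_add, ← mul_assoc (g ^ j) g,
      ← pow_succ, trace_add, trace_add, ih (j + 1), mul_smul_comm, mul_one, trace_smul, smul_eq_mul,
      ← mul_assoc]
    have h (i : ℕ) (_ : i ∈ range a) :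
        trace (g ^ (j + (i + 1))) * fderiv ℂ (detCoeff c (a + 1 - (i + 1))) g Y
          + trace (g ^ (j + (i + 1)) * Y * resCoeff c (a + 1 - 1 - (i + 1)) g)
        = trace (g ^ (j + 1 + i)) * fderiv ℂ (detCoeff c (a - i)) g Y
          + trace (g ^ (j + 1 + i) * Y * resCoeff c (a - 1 - i) g) := by
      have h1 : j + (i + 1) = j + 1 + i := by omega
      have h2 : a + 1 - 1 - (i + 1) = a - 1 - i := by omega
      rw [h1, h2, Nat.add_sub_add_right]
    rw [sum_congr rfl h, add_zero, Nat.sub_zero, Nat.sub_zero, Nat.add_sub_cancel]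
    ring

/-- The derivative of the coefficients of `det (1 - y g) ^ (-c)`. -/
lemma fderiv_detCoeff_succ_apply (c : ℂ) (a : ℕ) (g Y : Matrix ι ι ℂ) :
    fderiv ℂ (detCoeff c (a + 1)) g Y = c * trace (resCoeff c a g * Y) := by
  induction a using Nat.strong_induction_on with
  | _ a ih =>
    have ha : (a : ℂ) + 1 ≠ 0 := Nat.cast_add_one_ne_zero a
    refine mul_left_cancel₀ ha ?_
    rw [succ_mul_fderiv_detCoeff_succ_apply, trace_add, trace_mul_comm Y]
    have h1 := trace_pow_mul_fderiv_resCoeff c a 1 g Y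
    rw [pow_one] at h1
    rw [h1]
    cases a with
    | zero => simp
    | succ a =>
      -- With the induction hypothesis inserted, the unrolled sum is exactly the expansion of `(a +
      -- 1) • resCoeff c (a + 1) g` tested against `Y`.
      have h2 := congrArg (fun M => trace (M * Y)) (succ_smul_resCoeff_succ c a g)
      simp only [smul_mul_assoc, trace_smul, smul_eq_mul, sum_mul, trace_sum, add_mul,
        trace_add] at h2
      have h3 : ∀ i ∈ range (a + 1),
          trace (g ^ (1 + i)) * fderiv ℂ (detCoeff c (a + 1 - i)) g Y
            + trace (g ^ (1 + i) * Y * resCoeff c (a + 1 - 1 - i) g)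
          = c * trace (g ^ (i + 1)) * trace (resCoeff c (a - i) g * Y)
            + trace (g ^ (i + 1) * resCoeff c (a - i) g * Y) := by
        intro i hi
        have hi' := mem_range.1 hi
        have e : a + 1 - i = (a - i) + 1 := by omega
        rw [e, ih (a - i) (by omega), Nat.add_sub_cancel, add_comm 1 i, mul_assoc (g ^ (i + 1)),
          trace_mul_comm (g ^ (i + 1)) (Y * _), mul_assoc Y,
          ((commute_resCoeff c (a - i) g).symm.pow_right (i + 1)).eq, trace_mul_comm Y]
        ring
      rw [sum_congr rfl h3, ← h2]
      push_cast
      ring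

/-- The `A`-weighted divergence of a matrix field along left multiplication by matrix units. -/
noncomputable def leftDiv (A : Matrix ι ι ℂ) (V : Matrix ι ι ℂ → Matrix ι ι ℂ) (g : Matrix ι ι ℂ) :
    ℂ :=
  ∑ i, ∑ j, (A * fderiv ℂ V g (single i j 1 * g)) i j

lemma sum_single_mul_entry (A B : Matrix ι ι ℂ) :
    ∑ i : ι, ∑ j : ι, (A * (single i j (1 : ℂ) * B)) i j = trace A * trace B := by
  simp only [trace, diag_apply, sum_mul_sum]
  refine sum_congr rfl fun i _ => sum_congr rfl fun j _ => ?_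
  rw [← mul_assoc, mul_apply, sum_eq_single j]
  · simp
  · intro k _ hk
    rw [mul_single_apply_of_ne (hbj := hk), zero_mul]
  · simp

lemma sum_trace_single_mul_entry (A B : Matrix ι ι ℂ) :
    ∑ i : ι, ∑ j : ι, trace (A * single i j (1 : ℂ)) * B i j = trace (A * B) := by
  rw [sum_comm]
  simp only [trace, diag_apply, mul_apply]
  refine sum_congr rfl fun i _ => sum_congr rfl fun j _ => ?_
  have := trace_mul_single A j i (1 : ℂ)
  simp only [trace, diag_apply, mul_apply] at this
  rw [this]
  simp

/-- The weight `g ^ j` is there for the induction: the recursion passes a factor `g` into it. The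
product of traces from differentiating the explicit `g` is absorbed by the scalar term of
`resCoeff_succ`, and this is where `c * c = 1` is needed. -/
lemma leftDiv_resCoeff {c : ℂ} (hc : c * c = 1) (a j : ℕ) (g : Matrix ι ι ℂ) :
    leftDiv (g ^ j) (resCoeff c a) g = c * a * trace (g ^ j * resCoeff c a g) := by
  induction a generalizing j with
  | zero => simp [leftDiv]
  | succ a ih =>
    have h1 : leftDiv (g ^ j) (resCoeff c (a + 1)) g
        = c * trace (g ^ j * (g * resCoeff c a g)) + trace (g ^ j) * trace (g * resCoeff c a g)
          + leftDiv (g ^ (j + 1)) (resCoeff c a) g := by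
      simp only [leftDiv, fderiv_resCoeff_succ_apply, mul_add, add_apply, sum_add_distrib]
      rw [← add_assoc]
      congr 1
      · congr 1
        · simp only [fderiv_detCoeff_succ_apply, mul_smul_comm, mul_one, smul_apply, smul_eq_mul,
            mul_assoc c, ← mul_sum]
          congr 1
          simp only [← mul_assoc, trace_mul_comm _ g, sum_trace_single_mul_entry]
          rw [trace_mul_comm, ← mul_assoc]
        · simp only [mul_assoc, sum_single_mul_entry]
      · simp only [← mul_assoc, ← pow_succ]
    have h2 := succ_mul_detCoeff_succ c a g
    rw [h1, ih, resCoeff_succ, mul_add, trace_add, mul_smul_comm, mul_one, trace_smul, smul_eq_mul,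
      ← mul_assoc, ← pow_succ]
    push_cast
    linear_combination (-c) * trace (g ^ j) * h2
      - trace (g ^ j) * trace (g * resCoeff c a g) * hc

lemma leftDiv_add {V W : Matrix ι ι ℂ → Matrix ι ι ℂ} {g : Matrix ι ι ℂ} (A : Matrix ι ι ℂ)
    (hV : DifferentiableAt ℂ V g) (hW : DifferentiableAt ℂ W g) :
    leftDiv A (fun g => V g + W g) g = leftDiv A V g + leftDiv A W g := by
  simp only [leftDiv, fderiv_matrix_add_apply hV hW, mul_add, add_apply, sum_add_distrib]

lemma leftDiv_sub {V W : Matrix ι ι ℂ → Matrix ι ι ℂ} {g : Matrix ι ι ℂ} (A : Matrix ι ι ℂ)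
    (hV : DifferentiableAt ℂ V g) (hW : DifferentiableAt ℂ W g) :
    leftDiv A (fun g => V g - W g) g = leftDiv A V g - leftDiv A W g := by
  simp only [leftDiv, fderiv_matrix_sub_apply hV hW, mul_sub, sub_apply, sum_sub_distrib]

lemma leftDiv_detCoeff_smul (c : ℂ) (a : ℕ) {V : Matrix ι ι ℂ → Matrix ι ι ℂ} {g : Matrix ι ι ℂ}
    (hV : DifferentiableAt ℂ V g) :
    leftDiv 1 (fun g => detCoeff c (a + 1) g • V g) g
      = detCoeff c (a + 1) g * leftDiv 1 V g + c * trace (g * resCoeff c a g * V g) := by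
  simp only [leftDiv, fderiv_matrix_smul_apply (differentiableAt_detCoeff c (a + 1) g) hV, one_mul,
    add_apply, smul_apply, sum_add_distrib, smul_eq_mul, ← mul_sum, fderiv_detCoeff_succ_apply,
    mul_assoc c]
  congr 2
  simp only [← mul_assoc, trace_mul_comm _ g, sum_trace_single_mul_entry]

/-- The hook matrices are, up to a scalar, gradients of eigenfunctions of the Laplacian. -/
lemma leftDiv_hookMat (a b : ℕ) (g : Matrix ι ι ℂ) :
    leftDiv 1 (hookMat a b) g = ((Fintype.card ι : ℂ) + a - b) * trace (hookMat a b g) := by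
  induction b generalizing a with
  | zero =>
    have h0 : (hookMat a 0 : Matrix ι ι ℂ → _) = fun g => g * resCoeff 1 a g := by
      funext g
      exact hookMat_zero_right a g
    have h1 := leftDiv_resCoeff (c := 1) (by norm_num) a 1 g
    have h2 := sum_single_mul_entry (1 : Matrix ι ι ℂ) (g * resCoeff 1 a g)
    rw [h0, leftDiv]
    simp only [fderiv_id_mul_apply (differentiableAt_resCoeff 1 a g), one_mul, add_apply,
      sum_add_distrib]
    simp only [leftDiv, pow_one, one_mul] at h1
    simp only [one_mul, trace_one] at h2
    rw [h1]
    simp only [mul_assoc, h2]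
    push_cast
    ring
  | succ b ih =>
    have h0 : (hookMat a (b + 1) : Matrix ι ι ℂ → _) = fun g => hookMat (a + 1) b g
        + detCoeff (-1) (b + 1) g • resCoeff 1 (a + 1) g
        - detCoeff 1 (a + 1) g • resCoeff (-1) (b + 1) g := by
      funext g
      exact hookMat_succ_right a b g
    have d1 := differentiableAt_hookMat (a + 1) b g
    have d2 := differentiableAt_resCoeff 1 (a + 1) g
    have d3 := differentiableAt_resCoeff (-1) (b + 1) g
    have d4 := differentiableAt_detCoeff 1 (a + 1) g
    have d5 := differentiableAt_detCoeff (-1) (b + 1) g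
    have d7 : DifferentiableAt ℂ (fun g => detCoeff (-1) (b + 1) g • resCoeff 1 (a + 1) g) g :=
      d5.smul d2
    have d8 : DifferentiableAt ℂ (fun g => detCoeff 1 (a + 1) g • resCoeff (-1) (b + 1) g) g :=
      d4.smul d3
    have d6 : DifferentiableAt ℂ (fun g => hookMat (a + 1) b g
        + detCoeff (-1) (b + 1) g • resCoeff 1 (a + 1) g) g := d1.add d7
    have e1 := leftDiv_resCoeff (c := 1) (by norm_num) (a + 1) 0 g
    have e2 := leftDiv_resCoeff (c := -1) (by norm_num) (b + 1) 0 g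
    rw [pow_zero] at e1 e2
    simp only [one_mul] at e1 e2
    rw [trace_hookMat_succ_right, h0, leftDiv_sub 1 d6 d8, leftDiv_add 1 d1 d7,
      leftDiv_detCoeff_smul _ _ d2, leftDiv_detCoeff_smul _ _ d3, ih, e1, e2,
      trace_resCoeff (by norm_num), trace_resCoeff (by norm_num)]
    -- The cross terms of the product rule are again hook traces, so the expression closes up under
    -- the Pieri recursion.
    have t1 : trace (g * resCoeff (-1) b g * resCoeff 1 (a + 1) g) = trace (hookMat (a + 1) b g) := by
      rw [hookMat, mul_assoc, mul_assoc, (commute_resCoeff_resCoeff (-1) 1 b (a + 1) g).eq]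
    have t2 : trace (g * resCoeff 1 a g * resCoeff (-1) (b + 1) g) = trace (hookMat a (b + 1) g) := rfl
    rw [t1, t2, trace_hookMat_succ_right]
    push_cast
    ring

lemma fderiv_trace_pow_apply (n : ℕ) (g Y : Matrix ι ι ℂ) :
    fderiv ℂ (fun g : Matrix ι ι ℂ => trace (g ^ n)) g (Y * g) = n * trace (Y * g ^ n) := by
  have hd : ∀ n : ℕ, DifferentiableAt ℂ (fun g : Matrix ι ι ℂ => g ^ n) g := fun n =>
    (contDiff_id.pow n).differentiable one_ne_zero g
  have h : ∀ n j : ℕ, trace (g ^ j * fderiv ℂ (fun g : Matrix ι ι ℂ => g ^ n) g (Y * g))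
      = n * trace (Y * g ^ (n + j)) := by
    intro n
    induction n with
    | zero => simp
    | succ n ih =>
      intro j
      have : (fun g : Matrix ι ι ℂ => g ^ (n + 1)) = fun g => g * g ^ n := by
        funext g
        rw [pow_succ']
      rw [this, fderiv_id_mul_apply (hd n), mul_add, ← mul_assoc _ g, ← pow_succ, trace_add, ih,
        trace_mul_comm, mul_assoc Y, mul_assoc Y, ← pow_succ', ← pow_add]
      have e1 : n + 1 + j = n + (j + 1) := by omega
      rw [e1]
      push_cast
      ring
  rw [fderiv_trace_apply (hd n)]
  simpa using h n 0

end Calculus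

end Matrix

/-! ### Scalar invariance, and existence and uniqueness of the mean. -/

namespace UGroup

open Matrix

variable {S : ℕ}

instance instSecondCountableTopology (S : ℕ) : SecondCountableTopology (UGroup S) :=
  haveI : SecondCountableTopology (Matrix (Fin S) (Fin S) ℂ) :=
    inferInstanceAs (SecondCountableTopology (Fin S → Fin S → ℂ))
  TopologicalSpace.Subtype.secondCountableTopology _

instance instIsMulLeftInvariant (S : ℕ) : (haar S).IsMulLeftInvariant :=
  inferInstanceAs (Measure.haarMeasure _).IsMulLeftInvariant

instance instIsOpenPosMeasure (S : ℕ) : (haar S).IsOpenPosMeasure :=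
  inferInstanceAs (Measure.haarMeasure _).IsOpenPosMeasure

lemma integrable_of_continuous {F : UGroup S → ℂ} (hF : Continuous F) : Integrable F (haar S) :=
  hF.integrable_of_hasCompactSupport (HasCompactSupport.of_compactSpace F)

lemma continuous_coe : Continuous fun g : UGroup S => (g : Matrix (Fin S) (Fin S) ℂ) :=
  continuous_subtype_val

lemma continuous_det : Continuous (det : UGroup S → Circle) :=
  Continuous.subtype_mk continuous_coe.matrix_det _

/-- The scalar matrices of modulus one, as elements of `U(S)`. -/
noncomputable def scalar (S : ℕ) (z : Circle) : UGroup S :=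
  ⟨(z : ℂ) • (1 : Matrix (Fin S) (Fin S) ℂ), by
    rw [mem_unitaryGroup_iff, star_smul, star_one, smul_mul_smul_comm, one_mul, Complex.star_def,
      Complex.mul_conj, Circle.normSq_coe, Complex.ofReal_one, one_smul]⟩

lemma coe_scalar_mul (z : Circle) (g : UGroup S) :
    ((scalar S z * g : UGroup S) : Matrix (Fin S) (Fin S) ℂ) = (z : ℂ) • (g : Matrix _ _ ℂ) := by
  rw [Submonoid.coe_mul]
  simp [scalar]

lemma det_scalar_mul (z : Circle) (g : UGroup S) : det (scalar S z * g) = z ^ S * det g := by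
  apply Subtype.ext
  change Matrix.det ((scalar S z * g : UGroup S) : Matrix (Fin S) (Fin S) ℂ) = _
  rw [coe_scalar_mul, Matrix.det_smul, Fintype.card_fin]
  rfl

lemma absTraceSq_scalar_mul (n : ℕ) (z : Circle) (g : UGroup S) :
    absTraceSq S n (scalar S z * g) = absTraceSq S n g := by
  rw [absTraceSq, coe_scalar_mul, smul_pow, trace_smul, smul_eq_mul, norm_mul, norm_pow,
    Circle.norm_coe, one_pow, one_mul, absTraceSq]

lemma continuous_absTraceSq (S n : ℕ) : Continuous (absTraceSq S n) :=
  Complex.continuous_ofReal.comp ((continuous_coe.pow n).matrix_trace.norm.pow 2)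

lemma absTraceSq_conj (n : ℕ) (g h : UGroup S) :
    absTraceSq S n (h * g * h⁻¹) = absTraceSq S n g := by
  have h1 : ((h * g * h⁻¹ : UGroup S) : Matrix (Fin S) (Fin S) ℂ) ^ n
      = (h : Matrix (Fin S) (Fin S) ℂ) * (g : Matrix (Fin S) (Fin S) ℂ) ^ n
        * ((h⁻¹ : UGroup S) : Matrix (Fin S) (Fin S) ℂ) := by
    rw [← SubmonoidClass.coe_pow, conj_pow, Submonoid.coe_mul, Submonoid.coe_mul, SubmonoidClass.coe_pow]
  have h2 : ((h⁻¹ : UGroup S) : Matrix (Fin S) (Fin S) ℂ) * (h : Matrix (Fin S) (Fin S) ℂ) = 1 := by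
    rw [← Submonoid.coe_mul, inv_mul_cancel, Submonoid.coe_one]
  rw [absTraceSq, h1, trace_mul_comm, ← mul_assoc, h2, one_mul, absTraceSq]

lemma det_surjective (hS : 1 ≤ S) : Function.Surjective (det : UGroup S → Circle) := by
  intro z
  let i₀ : Fin S := ⟨0, hS⟩
  let d : Fin S → ℂ := Function.update 1 i₀ z
  have hd : ∀ i, d i * star (d i) = 1 := by
    intro i
    by_cases hi : i = i₀
    · subst hi
      simp [d, Complex.mul_conj]
    · simp [d, hi]
  refine ⟨⟨diagonal d, ?_⟩, ?_⟩
  · rw [mem_unitaryGroup_iff, star_eq_conjTranspose, diagonal_conjTranspose, diagonal_mul_diagonal,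
      ← diagonal_one]
    congr 1
    funext i
    exact hd i
  · apply Subtype.ext
    change Matrix.det (diagonal d) = z
    rw [det_diagonal, Finset.prod_update_of_mem (Finset.mem_univ _)]
    simp

/-- The average of `ψ` over the translates of the `S`-th powers in the circle does not depend on
the translate. -/
lemma intervalIntegral_circle_pow_mul (hS : 1 ≤ S) (ψ : Circle → ℂ) (w : Circle) :
    ∫ t in (0 : ℝ)..2 * Real.pi, ψ (Circle.exp t ^ S * w)
      = ∫ t in (0 : ℝ)..2 * Real.pi, ψ (Circle.exp t ^ S) := by
  obtain ⟨x, rfl⟩ : ∃ x : ℝ, Circle.exp x = w := ⟨_, Circle.exp_arg w⟩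
  have hS0 : (S : ℝ) ≠ 0 := by positivity
  have h1 : ∀ t : ℝ, ψ (Circle.exp t ^ S * Circle.exp x)
      = (fun t => ψ (Circle.exp t ^ S)) (t + x / S) := by
    intro t
    simp only
    congr 1
    rw [Circle.exp_add, mul_pow, ← Circle.exp_natCast_mul (x / S)]
    congr 2
    field_simp
  have hp : Function.Periodic (fun t => ψ (Circle.exp t ^ S)) (2 * Real.pi) := by
    intro t
    simp only
    rw [Circle.periodic_exp t]
  simp only [h1]
  rw [intervalIntegral.integral_comp_add_right (fun t => ψ (Circle.exp t ^ S)), zero_add, add_comm]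
  simpa using hp.intervalIntegral_add_eq (x / S) 0

/-- A continuous function invariant under multiplication by scalars is uncorrelated with every
function of the determinant. -/
lemma integral_mul_comp_det (hS : 1 ≤ S) {f : UGroup S → ℂ} (hf : Continuous f)
    (hinv : ∀ z g, f (scalar S z * g) = f g) {ψ : Circle → ℂ} (hψ : Continuous ψ) :
    (2 * Real.pi : ℂ) * ∫ g, f g * ψ (det g) ∂haar S
      = (∫ g, f g ∂haar S) * ∫ t in (0 : ℝ)..2 * Real.pi, ψ (Circle.exp t ^ S) := by
  have h1 : ∀ t : ℝ, ∫ g, f g * ψ (Circle.exp t ^ S * det g) ∂haar S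
      = ∫ g, f g * ψ (det g) ∂haar S := by
    intro t
    rw [← integral_mul_left_eq_self (fun g => f g * ψ (det g)) (scalar S (Circle.exp t))]
    simp only [hinv, det_scalar_mul]
  -- Averaging over all scalars and exchanging the integrals leaves an inner average of `ψ` that no
  -- longer depends on `det g`.
  have h2 : (2 * Real.pi : ℂ) * ∫ g, f g * ψ (det g) ∂haar S
      = ∫ t in (0 : ℝ)..2 * Real.pi, ∫ g, f g * ψ (Circle.exp t ^ S * det g) ∂haar S := by
    simp only [h1, intervalIntegral.integral_const]
    simp
  have hc : Continuous fun p : ℝ × UGroup S => f p.2 * ψ (Circle.exp p.1 ^ S * det p.2) := by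
    have := continuous_det (S := S)
    have h3 : Continuous fun t : ℝ => Circle.exp t := Circle.exp.continuous
    fun_prop
  have hi : Integrable (Function.uncurry fun (t : ℝ) g => f g * ψ (Circle.exp t ^ S * det g))
      ((volume.restrict (Set.Ioc 0 (2 * Real.pi))).prod (haar S)) := by
    have h3 : IntegrableOn (fun p : ℝ × UGroup S => f p.2 * ψ (Circle.exp p.1 ^ S * det p.2))
        (Set.Icc 0 (2 * Real.pi) ×ˢ Set.univ) (volume.prod (haar S)) :=
      hc.continuousOn.integrableOn_compact (isCompact_Icc.prod isCompact_univ)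
    have h4 := h3.mono_set (Set.prod_mono Set.Ioc_subset_Icc_self subset_rfl)
    rwa [IntegrableOn, ← Measure.prod_restrict, Measure.restrict_univ] at h4
  rw [h2, intervalIntegral.integral_of_le Real.two_pi_pos.le, integral_integral_swap hi]
  simp only [← intervalIntegral.integral_of_le Real.two_pi_pos.le,
    intervalIntegral.integral_const_mul, intervalIntegral_circle_pow_mul hS ψ]
  rw [integral_mul_const]

/-- The decoupling formula is applied to `f` and to the constant function with the same integral;
the right-hand sides agree. -/
lemma isMean_const (hS : 1 ≤ S) {f : UGroup S → ℂ} (hf : Continuous f)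
    (hinv : ∀ z g, f (scalar S z * g) = f g) : IsMean f fun _ => ∫ g, f g ∂haar S := by
  refine ⟨continuous_const, fun ψ hψ => ?_⟩
  have hpi : (2 * Real.pi : ℂ) ≠ 0 := by exact_mod_cast Real.two_pi_pos.ne'
  refine mul_left_cancel₀ hpi ?_
  rw [integral_mul_comp_det hS hf hinv hψ,
    integral_mul_comp_det hS continuous_const (fun _ _ => rfl) hψ]
  simp

/-- Testing against the conjugate of `F - G` makes the squared norm of `F - G` along `det` integrate
to zero. Haar measure charges open sets and `det` is onto the circle, so `F = G` everywhere. -/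
lemma IsMean.unique (hS : 1 ≤ S) {f : UGroup S → ℂ} {F G : Circle → ℂ} (hF : IsMean f F)
    (hG : IsMean f G) : F = G := by
  obtain ⟨hF, hF'⟩ := hF
  obtain ⟨hG, hG'⟩ := hG
  have hψ : Continuous fun z => star (F z - G z) := (hF.sub hG).star
  have hd := continuous_det (S := S)
  have h1 := (hF' _ hψ).symm.trans (hG' _ hψ)
  have h2 : ∫ g : UGroup S, ‖F (det g) - G (det g)‖ ^ 2 ∂haar S = 0 := by
    have i1 : Integrable (fun g => F (det g) * star (F (det g) - G (det g))) (haar S) :=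
      integrable_of_continuous (by fun_prop)
    have i2 : Integrable (fun g => G (det g) * star (F (det g) - G (det g))) (haar S) :=
      integrable_of_continuous (by fun_prop)
    have h3 := integral_sub i1 i2
    rw [h1, sub_self] at h3
    have h4 : ∀ g : UGroup S, F (det g) * star (F (det g) - G (det g))
        - G (det g) * star (F (det g) - G (det g))
        = ((‖F (det g) - G (det g)‖ ^ 2 : ℝ) : ℂ) := by
      intro g
      rw [← sub_mul, Complex.star_def, Complex.mul_conj, Complex.normSq_eq_norm_sq]
    simp only [h4] at h3
    rw [integral_complex_ofReal] at h3
    exact_mod_cast h3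
  have hc : Continuous fun g : UGroup S => ‖F (det g) - G (det g)‖ ^ 2 := by fun_prop
  rw [integral_eq_zero_iff_of_nonneg (fun g => by positivity)
    (hc.integrable_of_hasCompactSupport (HasCompactSupport.of_compactSpace _))] at h2
  have h3 := (hc.ae_eq_iff_eq (haar S) continuous_const).1 h2
  funext z
  obtain ⟨g, rfl⟩ := det_surjective hS z
  have h4 := congrFun h3 g
  have h5 : ‖F (det g) - G (det g)‖ ^ 2 = 0 := h4
  simpa [sub_eq_zero] using h5

end UGroup

/-! ### Integration by parts on `U(S)`. -/

namespace UGroup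

open Matrix
open scoped Matrix.Norms.Operator

variable {S : ℕ}

lemma continuousStar_matrix (S : ℕ) : ContinuousStar (Matrix (Fin S) (Fin S) ℂ) :=
  ⟨continuous_id.matrix_conjTranspose⟩

/-- The one-parameter subgroup of `U(S)` generated by a skew-Hermitian matrix. -/
noncomputable def expSkew {X : Matrix (Fin S) (Fin S) ℂ} (hX : X ∈ skewAdjoint (Matrix (Fin S) (Fin S) ℂ))
    (t : ℝ) : UGroup S :=
  ⟨NormedSpace.exp (t • X), @NormedSpace.exp_mem_unitary_of_mem_skewAdjoint _ _ _ _ _ (continuousStar_matrix S) _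
    (skewAdjoint.smul_mem t hX)⟩

/-- Infinitesimal invariance of Haar measure. -/
lemma integral_fderiv_skewAdjoint {X : Matrix (Fin S) (Fin S) ℂ}
    (hX : X ∈ skewAdjoint (Matrix (Fin S) (Fin S) ℂ)) {F : Matrix (Fin S) (Fin S) ℂ → ℂ}
    (hF : ContDiff ℝ 1 F) :
    ∫ g : UGroup S, fderiv ℝ F (g : Matrix (Fin S) (Fin S) ℂ) (X * (g : Matrix (Fin S) (Fin S) ℂ)) ∂haar S = 0 := by
  have hG : Continuous fun g : Matrix (Fin S) (Fin S) ℂ => fderiv ℝ F g (X * g) :=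
    (hF.continuous_fderiv one_ne_zero).clm_apply (continuous_const.mul continuous_id)
  have hG' : Continuous fun g : UGroup S => fderiv ℝ F (g : Matrix (Fin S) (Fin S) ℂ)
      (X * (g : Matrix (Fin S) (Fin S) ℂ)) := hG.comp continuous_coe
  have hF' : Continuous fun g : UGroup S => F (g : Matrix (Fin S) (Fin S) ℂ) :=
    hF.continuous.comp continuous_coe
  obtain ⟨C, hC⟩ := (isCompact_univ (X := UGroup S)).exists_bound_of_continuousOn hG'.continuousOn
  have hd (g : UGroup S) (t : ℝ) : HasDerivAt
      (fun t => F ((expSkew hX t * g : UGroup S) : Matrix (Fin S) (Fin S) ℂ))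
      (fderiv ℝ F ((expSkew hX t * g : UGroup S) : Matrix (Fin S) (Fin S) ℂ)
        (X * ((expSkew hX t * g : UGroup S) : Matrix (Fin S) (Fin S) ℂ))) t := by
    have h1 : HasDerivAt (fun t : ℝ => NormedSpace.exp (t • X) * (g : Matrix (Fin S) (Fin S) ℂ))
        (X * NormedSpace.exp (t • X) * (g : Matrix (Fin S) (Fin S) ℂ)) t :=
      (hasDerivAt_exp_smul_const' (𝕂 := ℝ) X t).mul_const _
    have h2 := ((hF.differentiable one_ne_zero _).hasFDerivAt).comp_hasDerivAt t h1
    rw [mul_assoc] at h2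
    exact h2
  have key := (hasDerivAt_integral_of_dominated_loc_of_deriv_le (μ := haar S) (s := Set.univ)
    (F := fun t (g : UGroup S) => F ((expSkew hX t * g : UGroup S) : Matrix (Fin S) (Fin S) ℂ))
    (F' := fun t (g : UGroup S) => fderiv ℝ F ((expSkew hX t * g : UGroup S) : Matrix (Fin S) (Fin S) ℂ)
        (X * ((expSkew hX t * g : UGroup S) : Matrix (Fin S) (Fin S) ℂ))) (x₀ := 0)
    (bound := fun _ => C) Filter.univ_mem
    (Filter.Eventually.of_forall fun t =>
      (hF'.comp (continuous_const.mul continuous_id)).aestronglyMeasurable)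
    (integrable_of_continuous (hF'.comp (continuous_const.mul continuous_id)))
    (hG'.comp (continuous_const.mul continuous_id)).aestronglyMeasurable
    (Filter.Eventually.of_forall fun g t _ => hC _ (Set.mem_univ _))
    (integrable_const C)
    (Filter.Eventually.of_forall fun g t _ => hd g t)).2
  have h1 : ∀ t, ∫ g : UGroup S, F ((expSkew hX t * g : UGroup S) : Matrix (Fin S) (Fin S) ℂ) ∂haar S
      = ∫ g : UGroup S, F (g : Matrix (Fin S) (Fin S) ℂ) ∂haar S := fun t =>
    integral_mul_left_eq_self (fun g : UGroup S => F (g : Matrix (Fin S) (Fin S) ℂ)) (expSkew hX t)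
  simp only [h1] at key
  rw [integral_mul_left_eq_self (fun g : UGroup S => fderiv ℝ F (g : Matrix (Fin S) (Fin S) ℂ)
      (X * (g : Matrix (Fin S) (Fin S) ℂ)))] at key
  exact key.unique (hasDerivAt_const _ _)

lemma continuous_fderiv_mul {f : Matrix (Fin S) (Fin S) ℂ → ℂ} (hf : ContDiff ℂ 1 f)
    (X : Matrix (Fin S) (Fin S) ℂ) :
    Continuous fun g : UGroup S => fderiv ℂ f (g : Matrix (Fin S) (Fin S) ℂ)
      (X * (g : Matrix (Fin S) (Fin S) ℂ)) :=
  ((hf.continuous_fderiv one_ne_zero).clm_apply (continuous_const.mul continuous_id)).comp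
    continuous_coe

lemma continuous_comp_coe {f : Matrix (Fin S) (Fin S) ℂ → ℂ} (hf : ContDiff ℂ 1 f) :
    Continuous fun g : UGroup S => f (g : Matrix (Fin S) (Fin S) ℂ) :=
  hf.continuous.comp continuous_coe

/-- Writing `-star X` for `X` in the conjugated factor makes the integrand complex linear in `X`, so
the identity can be extended beyond skew-Hermitian directions. -/
lemma integral_fderiv_mul_star_skewAdjoint {X : Matrix (Fin S) (Fin S) ℂ}
    (hX : X ∈ skewAdjoint (Matrix (Fin S) (Fin S) ℂ)) {f h : Matrix (Fin S) (Fin S) ℂ → ℂ}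
    (hf : ContDiff ℂ 1 f) (hh : ContDiff ℂ 1 h) :
    ∫ g : UGroup S, (fderiv ℂ f (g : Matrix (Fin S) (Fin S) ℂ) (X * (g : Matrix (Fin S) (Fin S) ℂ))
        * star (h (g : Matrix (Fin S) (Fin S) ℂ))
      - f (g : Matrix (Fin S) (Fin S) ℂ)
        * star (fderiv ℂ h (g : Matrix (Fin S) (Fin S) ℂ) (star X * (g : Matrix (Fin S) (Fin S) ℂ))))
      ∂haar S = 0 := by
  have hF : ContDiff ℝ 1 fun g => f g * star (h g) :=
    (hf.restrict_scalars ℝ).mul ((starL' ℝ (A := ℂ)).contDiff.comp (hh.restrict_scalars ℝ))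
  rw [← integral_fderiv_skewAdjoint hX hF]
  congr 1
  funext g
  have h1 := ((hf.differentiable one_ne_zero (g : Matrix (Fin S) (Fin S) ℂ)).hasFDerivAt).restrictScalars ℝ
  have h2 := ((hh.differentiable one_ne_zero (g : Matrix (Fin S) (Fin S) ℂ)).hasFDerivAt).restrictScalars ℝ
  have h3 := (h1.mul ((starL' ℝ (A := ℂ)).hasFDerivAt.comp _ h2)).fderiv
  have h4 := congrArg (fun L => L (X * (g : Matrix (Fin S) (Fin S) ℂ))) h3
  refine Eq.trans ?_ h4.symm
  change _ = f g * star (fderiv ℂ h (g : Matrix (Fin S) (Fin S) ℂ) (X * g))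
    + star (h g) * fderiv ℂ f (g : Matrix (Fin S) (Fin S) ℂ) (X * g)
  rw [skewAdjoint.mem_iff.1 hX, neg_mul, map_neg, star_neg]
  ring

/-- Integration by parts on `U(S)` for products of a holomorphic and an antiholomorphic function. -/
lemma integral_fderiv_mul_star {f h : Matrix (Fin S) (Fin S) ℂ → ℂ}
    (hf : ContDiff ℂ 1 f) (hh : ContDiff ℂ 1 h) (X : Matrix (Fin S) (Fin S) ℂ) :
    ∫ g : UGroup S, fderiv ℂ f (g : Matrix (Fin S) (Fin S) ℂ) (X * (g : Matrix (Fin S) (Fin S) ℂ))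
        * star (h (g : Matrix (Fin S) (Fin S) ℂ)) ∂haar S
      = ∫ g : UGroup S, f (g : Matrix (Fin S) (Fin S) ℂ)
        * star (fderiv ℂ h (g : Matrix (Fin S) (Fin S) ℂ) (star X * (g : Matrix (Fin S) (Fin S) ℂ)))
        ∂haar S := by
  have c1 := continuous_comp_coe hf
  have c2 := continuous_comp_coe hh
  have c3 := continuous_fderiv_mul hf
  have c4 := continuous_fderiv_mul hh
  -- Every matrix is `A + I • B` with `A` and `B` skew-Hermitian; these are the two parts of `X`.
  have hA : (1 / 2 : ℂ) • (X - star X) ∈ skewAdjoint (Matrix (Fin S) (Fin S) ℂ) := by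
    rw [skewAdjoint.mem_iff, star_smul, star_sub, star_star, ← smul_neg, neg_sub]
    simp
  have hB : (-Complex.I / 2) • (X + star X) ∈ skewAdjoint (Matrix (Fin S) (Fin S) ℂ) := by
    rw [skewAdjoint.mem_iff, star_smul, star_add, star_star, ← neg_smul, add_comm]
    congr 1
    simp [neg_div]
  have iA := integral_fderiv_mul_star_skewAdjoint hA hf hh
  have iB := integral_fderiv_mul_star_skewAdjoint hB hf hh
  have i1 : Integrable (fun g : UGroup S => fderiv ℂ f (g : Matrix (Fin S) (Fin S) ℂ)
      (X * (g : Matrix (Fin S) (Fin S) ℂ)) * star (h (g : Matrix (Fin S) (Fin S) ℂ))) (haar S) :=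
    integrable_of_continuous ((c3 X).mul c2.star)
  have i2 : Integrable (fun g : UGroup S => f (g : Matrix (Fin S) (Fin S) ℂ)
      * star (fderiv ℂ h (g : Matrix (Fin S) (Fin S) ℂ)
        (star X * (g : Matrix (Fin S) (Fin S) ℂ)))) (haar S) :=
    integrable_of_continuous (c1.mul (c4 (star X)).star)
  rw [← sub_eq_zero, ← integral_sub i1 i2]
  have e : (0 : ℂ) = 0 + Complex.I * 0 := by ring
  rw [e]
  nth_rewrite 1 [← iA]
  rw [← iB, ← integral_const_mul, ← integral_add]
  · congr 1
    funext g
    have hI := Complex.I_mul_I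
    simp only [star_smul, star_sub, star_add, star_star, smul_mul_assoc, map_smul, sub_mul, add_mul,
      map_sub, map_add, smul_eq_mul, star_mul', Complex.star_def, map_div₀, map_neg, Complex.conj_I,
      map_one, map_ofNat]
    generalize (fderiv ℂ f (g : Matrix (Fin S) (Fin S) ℂ)) (X * (g : Matrix (Fin S) (Fin S) ℂ)) = a
    ring_nf
    simp only [Complex.I_sq]
    ring
  · exact integrable_of_continuous (((c3 _).mul c2.star).sub (c1.mul (c4 _).star))
  · exact (integrable_of_continuous (((c3 _).mul c2.star).sub (c1.mul (c4 _).star))).const_mul _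

end UGroup

/-! ### Loop equation and evaluation of the moments. -/

namespace UGroup

open Matrix Finset
open scoped Matrix.Norms.Operator

variable {S : ℕ}

lemma trace_mul_star_eq_sum (A B : Matrix (Fin S) (Fin S) ℂ) :
    trace (A * star B) = ∑ i, ∑ j, A i j * star (B i j) := by
  simp [trace, mul_apply, star_apply]

/-- The loop equation for hook matrices. -/
lemma loop_equation (a b m : ℕ) :
    ((S : ℂ) + a - b) * ∫ g : UGroup S, trace (hookMat a b (g : Matrix (Fin S) (Fin S) ℂ))
        * star (trace ((g : Matrix (Fin S) (Fin S) ℂ) ^ m)) ∂haar S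
      = m * ∫ g : UGroup S, trace (hookMat a b (g : Matrix (Fin S) (Fin S) ℂ)
        * star ((g : Matrix (Fin S) (Fin S) ℂ) ^ m)) ∂haar S := by
  have hV := contDiff_hookMat (ι := Fin S) a b
  have hp : ContDiff ℂ 1 fun g : Matrix (Fin S) (Fin S) ℂ => trace (g ^ m) :=
    contDiff_trace (contDiff_id.pow m)
  have cp := continuous_comp_coe hp
  have h := fun i j => integral_fderiv_mul_star (contDiff_entry hV i j) hp (single i j 1)
  have hl : ∀ g : UGroup S, ((S : ℂ) + a - b)
      * (trace (hookMat a b (g : Matrix (Fin S) (Fin S) ℂ))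
        * star (trace ((g : Matrix (Fin S) (Fin S) ℂ) ^ m)))
      = ∑ i, ∑ j, fderiv ℂ (fun g => hookMat a b g i j) (g : Matrix (Fin S) (Fin S) ℂ)
          (single i j 1 * (g : Matrix (Fin S) (Fin S) ℂ))
          * star (trace ((g : Matrix (Fin S) (Fin S) ℂ) ^ m)) := by
    intro g
    have h1 := leftDiv_hookMat a b (g : Matrix (Fin S) (Fin S) ℂ)
    rw [Fintype.card_fin] at h1
    rw [← mul_assoc, ← h1, leftDiv]
    simp only [one_mul, sum_mul, fderiv_entry_apply (differentiableAt_hookMat a b _)]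
  have hr : ∀ g : UGroup S, (m : ℂ) * trace (hookMat a b (g : Matrix (Fin S) (Fin S) ℂ)
        * star ((g : Matrix (Fin S) (Fin S) ℂ) ^ m))
      = ∑ i, ∑ j, hookMat a b (g : Matrix (Fin S) (Fin S) ℂ) i j
          * star (fderiv ℂ (fun g : Matrix (Fin S) (Fin S) ℂ => trace (g ^ m))
            (g : Matrix (Fin S) (Fin S) ℂ)
            (star (single i j 1) * (g : Matrix (Fin S) (Fin S) ℂ))) := by
    intro g
    rw [trace_mul_star_eq_sum, mul_sum]
    refine sum_congr rfl fun i _ => ?_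
    rw [mul_sum]
    refine sum_congr rfl fun j _ => ?_
    rw [fderiv_trace_pow_apply, star_eq_conjTranspose, conjTranspose_single, star_one,
      trace_single_mul, smul_eq_mul, one_mul, star_mul', star_natCast]
    ring
  rw [← integral_const_mul, ← integral_const_mul]
  simp only [hl, hr]
  rw [integral_finsetSum, integral_finsetSum]
  · refine sum_congr rfl fun i _ => ?_
    rw [integral_finsetSum, integral_finsetSum]
    · exact sum_congr rfl fun j _ => h i j
    · exact fun j _ => integrable_of_continuous
        ((continuous_comp_coe (contDiff_entry hV i j)).mul (continuous_fderiv_mul hp _).star)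
    · exact fun j _ => integrable_of_continuous
        ((continuous_fderiv_mul (contDiff_entry hV i j) _).mul cp.star)
  · exact fun i _ => integrable_finsetSum _ fun j _ => integrable_of_continuous
        ((continuous_comp_coe (contDiff_entry hV i j)).mul (continuous_fderiv_mul hp _).star)
  · exact fun i _ => integrable_finsetSum _ fun j _ => integrable_of_continuous
        ((continuous_fderiv_mul (contDiff_entry hV i j) _).mul cp.star)

/-- The Haar average of a function against the conjugate of the `m`-th power sum. -/
noncomputable def powerMoment (m : ℕ) (f : Matrix (Fin S) (Fin S) ℂ → ℂ) : ℂ :=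
  ∫ g : UGroup S, f (g : Matrix (Fin S) (Fin S) ℂ)
    * star (trace ((g : Matrix (Fin S) (Fin S) ℂ) ^ m)) ∂haar S

lemma continuous_star_trace_pow (m : ℕ) :
    Continuous fun g : UGroup S => star (trace ((g : Matrix (Fin S) (Fin S) ℂ) ^ m)) :=
  (continuous_coe.pow m).matrix_trace.star

lemma integrable_mul_star_trace_pow (m : ℕ) {f : Matrix (Fin S) (Fin S) ℂ → ℂ}
    (hf : ContDiff ℂ 1 f) :
    Integrable (fun g : UGroup S => f (g : Matrix (Fin S) (Fin S) ℂ)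
      * star (trace ((g : Matrix (Fin S) (Fin S) ℂ) ^ m))) (haar S) :=
  integrable_of_continuous ((continuous_comp_coe hf).mul (continuous_star_trace_pow m))

lemma powerMoment_const_mul (m : ℕ) (c : ℂ) (f : Matrix (Fin S) (Fin S) ℂ → ℂ) :
    powerMoment m (fun g => c * f g) = c * powerMoment m f := by
  simp only [powerMoment, mul_assoc, integral_const_mul]

lemma powerMoment_add (m : ℕ) {f h : Matrix (Fin S) (Fin S) ℂ → ℂ} (hf : ContDiff ℂ 1 f)
    (hh : ContDiff ℂ 1 h) :
    powerMoment m (fun g => f g + h g) = powerMoment m f + powerMoment m h := by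
  simp only [powerMoment, add_mul]
  exact integral_add (integrable_mul_star_trace_pow m hf) (integrable_mul_star_trace_pow m hh)

/-- The average of the product of a complete and a (signed) elementary symmetric function of the
eigenvalues against the conjugate power sum. -/
noncomputable def prodMoment (S a b : ℕ) : ℂ :=
  powerMoment (a + b) fun g : Matrix (Fin S) (Fin S) ℂ => detCoeff 1 a g * detCoeff (-1) b g

/-- The average of the trace of a hook matrix against the conjugate power sum. -/
noncomputable def hookMoment (S a b : ℕ) : ℂ :=
  powerMoment (a + b + 1) fun g : Matrix (Fin S) (Fin S) ℂ => trace (hookMat a b g)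

/-- The average of a hook matrix paired with the conjugate transposed power. -/
noncomputable def pairMoment (S a b : ℕ) : ℂ :=
  ∫ g : UGroup S, trace (hookMat a b (g : Matrix (Fin S) (Fin S) ℂ)
    * star ((g : Matrix (Fin S) (Fin S) ℂ) ^ (a + b + 1))) ∂haar S

lemma contDiff_detCoeff_mul (a b : ℕ) :
    ContDiff ℂ 1 fun g : Matrix (Fin S) (Fin S) ℂ => detCoeff 1 a g * detCoeff (-1) b g :=
  (contDiff_detCoeff 1 a).mul (contDiff_detCoeff (-1) b)

lemma mul_hookMoment (a b : ℕ) :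
    ((S : ℂ) + a - b) * hookMoment S a b = ((a : ℂ) + b + 1) * pairMoment S a b := by
  have := loop_equation (S := S) a b (a + b + 1)
  push_cast at this
  exact this

lemma hookMoment_succ_right (a b : ℕ) :
    hookMoment S a (b + 1)
      = hookMoment S (a + 1) b + ((a : ℂ) + b + 2) * prodMoment S (a + 1) (b + 1) := by
  have e1 : a + (b + 1) + 1 = a + 1 + b + 1 := by omega
  have e2 : a + 1 + (b + 1) = a + 1 + b + 1 := by omega
  rw [hookMoment, hookMoment, prodMoment, e1, e2, ← powerMoment_const_mul,
    ← powerMoment_add _ (contDiff_trace (contDiff_hookMat _ _))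
      (contDiff_const.mul (contDiff_detCoeff_mul _ _))]
  simp only [trace_hookMat_succ_right]

lemma hookMoment_zero_right (a : ℕ) :
    hookMoment S a 0 = ((a : ℂ) + 1) * prodMoment S (a + 1) 0 := by
  rw [hookMoment, prodMoment, ← powerMoment_const_mul]
  simp only [trace_hookMat_zero_right, detCoeff_zero, mul_one, add_zero]

lemma hookMoment_zero_left (b : ℕ) :
    hookMoment S 0 b = -(((b : ℂ) + 1) * prodMoment S 0 (b + 1)) := by
  rw [hookMoment, prodMoment, ← neg_mul, ← powerMoment_const_mul]
  simp only [trace_hookMat_zero_left, detCoeff_zero, one_mul, zero_add, neg_mul]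

lemma prodMoment_zero_zero : prodMoment S 0 0 = S := by
  simp [prodMoment, powerMoment]

lemma trace_pow_mul_star_pow (g : UGroup S) (i k : ℕ) :
    trace ((g : Matrix (Fin S) (Fin S) ℂ) ^ i * star ((g : Matrix (Fin S) (Fin S) ℂ) ^ (k + i)))
      = star (trace ((g : Matrix (Fin S) (Fin S) ℂ) ^ k)) := by
  have h : (g : Matrix (Fin S) (Fin S) ℂ) ^ i * star ((g : Matrix (Fin S) (Fin S) ℂ) ^ i) = 1 :=
    mem_unitaryGroup_iff.1 (pow_mem g.2 i)
  rw [pow_add, star_mul, ← mul_assoc, h, one_mul, star_eq_conjTranspose, trace_conjTranspose]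

/-- Unitarity cancels each power of `g` in `resCoeff_eq_sum` against the adjoint power. Every
summand becomes a product of the shape integrated in `prodMoment`, of degree at most `a + k`. -/
lemma trace_resCoeff_mul_star_pow (c : ℂ) (a k : ℕ) (g : UGroup S) :
    trace (resCoeff c a (g : Matrix (Fin S) (Fin S) ℂ)
        * star ((g : Matrix (Fin S) (Fin S) ℂ) ^ (a + k)))
      = ∑ i ∈ range (a + 1), detCoeff c i (g : Matrix (Fin S) (Fin S) ℂ)
        * star (trace ((g : Matrix (Fin S) (Fin S) ℂ) ^ (i + k))) := by
  rw [resCoeff_eq_sum, sum_mul, trace_sum, ← sum_range_reflect]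
  refine sum_congr rfl fun i hi => ?_
  have hi' := mem_range.1 hi
  have e1 : a - (a + 1 - 1 - i) = i := by omega
  have e2 : a + k = (i + k) + (a + 1 - 1 - i) := by omega
  rw [e1, e2, smul_mul_assoc, trace_smul, trace_pow_mul_star_pow, smul_eq_mul]

lemma continuous_trace_mul_star_pow {V : Matrix (Fin S) (Fin S) ℂ → Matrix (Fin S) (Fin S) ℂ}
    (hV : ContDiff ℂ 1 V) (m : ℕ) :
    Continuous fun g : UGroup S => trace (V (g : Matrix (Fin S) (Fin S) ℂ)
      * star ((g : Matrix (Fin S) (Fin S) ℂ) ^ m)) :=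
  ((hV.continuous.comp continuous_coe).matrix_mul
    (continuous_coe.pow m).matrix_conjTranspose).matrix_trace

lemma pairMoment_zero_right (a : ℕ) :
    pairMoment S a 0 = ∑ i ∈ range (a + 1), prodMoment S i 0 := by
  have h : ∀ g : UGroup S, trace (hookMat a 0 (g : Matrix (Fin S) (Fin S) ℂ)
      * star ((g : Matrix (Fin S) (Fin S) ℂ) ^ (a + 1)))
      = ∑ i ∈ range (a + 1), detCoeff 1 i (g : Matrix (Fin S) (Fin S) ℂ)
          * detCoeff (-1) 0 (g : Matrix (Fin S) (Fin S) ℂ)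
        * star (trace ((g : Matrix (Fin S) (Fin S) ℂ) ^ (i + 0))) := by
    intro g
    have h2 := trace_resCoeff_mul_star_pow 1 a 0 g
    have h1 : (g : Matrix (Fin S) (Fin S) ℂ) * star (g : Matrix (Fin S) (Fin S) ℂ) = 1 :=
      mem_unitaryGroup_iff.1 g.2
    simp only [detCoeff_zero, mul_one]
    rw [← h2, add_zero, hookMat_zero_right, (commute_resCoeff 1 a _).eq, pow_succ,
      star_mul, ← mul_assoc, mul_assoc (resCoeff 1 a _), h1, mul_one]
  have i1 := fun i => integrable_mul_star_trace_pow (S := S) (i + 0) (contDiff_detCoeff_mul i 0)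
  simp only [prodMoment, powerMoment]
  rw [← integral_finsetSum _ fun i _ => i1 i]
  exact integral_congr_ae (Filter.Eventually.of_forall h)

lemma pairMoment_succ_right (a b : ℕ) :
    pairMoment S a (b + 1) = pairMoment S (a + 1) b
      + ∑ i ∈ range (a + 2), prodMoment S i (b + 1)
      - ∑ i ∈ range (b + 2), prodMoment S (a + 1) i := by
  have h : ∀ g : UGroup S, trace (hookMat a (b + 1) (g : Matrix (Fin S) (Fin S) ℂ)
      * star ((g : Matrix (Fin S) (Fin S) ℂ) ^ (a + (b + 1) + 1)))
      = trace (hookMat (a + 1) b (g : Matrix (Fin S) (Fin S) ℂ)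
          * star ((g : Matrix (Fin S) (Fin S) ℂ) ^ (a + 1 + b + 1)))
        + ∑ i ∈ range (a + 2), detCoeff 1 i (g : Matrix (Fin S) (Fin S) ℂ)
          * detCoeff (-1) (b + 1) (g : Matrix (Fin S) (Fin S) ℂ)
          * star (trace ((g : Matrix (Fin S) (Fin S) ℂ) ^ (i + (b + 1))))
        - ∑ i ∈ range (b + 2), detCoeff 1 (a + 1) (g : Matrix (Fin S) (Fin S) ℂ)
          * detCoeff (-1) i (g : Matrix (Fin S) (Fin S) ℂ)
          * star (trace ((g : Matrix (Fin S) (Fin S) ℂ) ^ (a + 1 + i))) := by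
    intro g
    have e1 : a + (b + 1) + 1 = a + 1 + b + 1 := by omega
    have e2 : a + 1 + b + 1 = (a + 1) + (b + 1) := by omega
    have e3 : a + 1 + b + 1 = (b + 1) + (a + 1) := by omega
    have s1 := trace_resCoeff_mul_star_pow 1 (a + 1) (b + 1) g
    have s2 := trace_resCoeff_mul_star_pow (-1) (b + 1) (a + 1) g
    rw [← e2] at s1
    rw [← e3] at s2
    rw [e1, hookMat_succ_right, sub_mul, add_mul, trace_sub, trace_add, smul_mul_assoc,
      smul_mul_assoc, trace_smul, trace_smul, s1, s2, smul_eq_mul, smul_eq_mul, mul_sum, mul_sum]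
    congr 1
    · congr 1
      exact sum_congr rfl fun i _ => by ring
    · refine sum_congr rfl fun i _ => ?_
      rw [add_comm i (a + 1)]
      ring
  have i1 : Integrable (fun g : UGroup S => trace (hookMat (a + 1) b (g : Matrix (Fin S) (Fin S) ℂ)
          * star ((g : Matrix (Fin S) (Fin S) ℂ) ^ (a + 1 + b + 1)))) (haar S) :=
    integrable_of_continuous (continuous_trace_mul_star_pow (contDiff_hookMat _ _) _)
  have i2 := fun i => integrable_mul_star_trace_pow (S := S) (i + (b + 1))
    (contDiff_detCoeff_mul i (b + 1))
  have i3 := fun i => integrable_mul_star_trace_pow (S := S) (a + 1 + i)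
    (contDiff_detCoeff_mul (a + 1) i)
  have i4 := integrable_finsetSum (range (a + 2)) fun i _ => i2 i
  have i5 := integrable_finsetSum (range (b + 2)) fun i _ => i3 i
  have i6 : Integrable (fun g : UGroup S => trace (hookMat (a + 1) b (g : Matrix (Fin S) (Fin S) ℂ)
          * star ((g : Matrix (Fin S) (Fin S) ℂ) ^ (a + 1 + b + 1)))
        + ∑ i ∈ range (a + 2), detCoeff 1 i (g : Matrix (Fin S) (Fin S) ℂ)
          * detCoeff (-1) (b + 1) (g : Matrix (Fin S) (Fin S) ℂ)
          * star (trace ((g : Matrix (Fin S) (Fin S) ℂ) ^ (i + (b + 1))))) (haar S) := i1.add i4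
  simp only [pairMoment, h, prodMoment, powerMoment]
  rw [integral_sub i6 i5, integral_add i1 i4, integral_finsetSum _ fun i _ => i2 i,
    integral_finsetSum _ fun i _ => i3 i]

/-- The hook Schur functions with fewer than `S` rows below the first have inner product `±1` with
the power sum of the same degree. -/
lemma hookMoment_eq (a : ℕ) {b : ℕ} (hb : b < S) : hookMoment S a b = (a : ℂ) + b + 1 := by
  induction hn : a + b + 1 using Nat.strong_induction_on generalizing a b with
  | _ n ih =>
    -- Hook moments of lower degree determine the product moments of lower degree: `1` for a pure
    -- row, `-1` for a pure column, `0` for a mixed product.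
    have ih' : ∀ i j, i + j + 1 < n → j < S → hookMoment S i j = (i : ℂ) + j + 1 :=
      fun i j hij hj => ih _ hij i hj rfl
    have m1 : ∀ i, i + 1 < n → prodMoment S (i + 1) 0 = 1 := by
      intro i hi
      have h := hookMoment_zero_right (S := S) i
      rw [ih' i 0 (by omega) (by omega), Nat.cast_zero, add_zero] at h
      refine mul_left_cancel₀ (Nat.cast_add_one_ne_zero i : (i : ℂ) + 1 ≠ 0) ?_
      linear_combination -h
    have m2 : ∀ i, i + 1 < n → i < S → prodMoment S 0 (i + 1) = -1 := by
      intro i hi hiS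
      have h := hookMoment_zero_left (S := S) i
      rw [ih' 0 i (by omega) hiS, Nat.cast_zero, zero_add] at h
      refine mul_left_cancel₀ (Nat.cast_add_one_ne_zero i : (i : ℂ) + 1 ≠ 0) ?_
      linear_combination h
    have m3 : ∀ i j, i + j + 2 < n → j + 1 < S → prodMoment S (i + 1) (j + 1) = 0 := by
      intro i j hi hj
      have h := hookMoment_succ_right (S := S) i j
      rw [ih' i (j + 1) (by omega) hj, ih' (i + 1) j (by omega) (by omega)] at h
      have h0 : (i : ℂ) + j + 2 ≠ 0 := by exact_mod_cast (by omega : i + j + 2 ≠ 0)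
      refine (mul_eq_zero.1 ?_).resolve_left h0
      push_cast at h
      linear_combination -h
    have key : ∀ b a, a + b + 1 = n → b < S → pairMoment S a b = (S : ℂ) + a - b := by
      intro b
      induction b with
      | zero =>
        intro a ha _
        rw [pairMoment_zero_right, sum_range_succ', prodMoment_zero_zero,
          sum_congr rfl fun i hi => m1 i (by have := mem_range.1 hi; omega)]
        simp [add_comm]
      | succ b ihb =>
        intro a ha hbS
        -- Both sums end in `prodMoment S (a + 1) (b + 1)`, of the still unknown degree `n`; these
        -- terms cancel. The mixed terms vanish and the two boundary terms contribute `-1 - 1`,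
        -- which takes `S + (a + 1) - b` to `S + a - (b + 1)`.
        rw [pairMoment_succ_right, ihb (a + 1) (by omega) (by omega), sum_range_succ',
          sum_range_succ, sum_range_succ' _ (b + 1), sum_range_succ _ b,
          m2 b (by omega) (by omega), m1 a (by omega),
          sum_congr rfl fun i hi => m3 i b (by have := mem_range.1 hi; omega) hbS,
          sum_congr rfl fun i hi => m3 a i (by have := mem_range.1 hi; omega)
            (by have := mem_range.1 hi; omega)]
        simp only [sum_const_zero]
        push_cast
        ring
    have h := mul_hookMoment (S := S) a b
    rw [key b a hn hb] at h
    -- The bound `b < S` keeps the divergence factor nonzero, so it can be cancelled from the loop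
    -- equation.
    have h0 : (S : ℂ) + a - b ≠ 0 := by
      rw [sub_ne_zero]
      exact_mod_cast (by omega : S + a ≠ b)
    refine mul_left_cancel₀ h0 ?_
    rw [h]
    ring

lemma hookMoment_eq_zero (hS : 1 ≤ S) (a : ℕ) {b : ℕ} (hb : S ≤ b) : hookMoment S a b = 0 := by
  simp [hookMoment, powerMoment, hookMat_eq_zero hS a hb]

/-- The second absolute moment of the power sums. -/
lemma integral_absTraceSq (hS : 1 ≤ S) {n : ℕ} (hn : 1 ≤ n) :
    ∫ g, absTraceSq S n g ∂haar S = ((min n S : ℕ) : ℂ) := by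
  obtain ⟨m, rfl⟩ : ∃ m, n = m + 1 := ⟨n - 1, by omega⟩
  have hm : (m : ℂ) + 1 ≠ 0 := Nat.cast_add_one_ne_zero m
  have h : ∀ g : UGroup S, ((m : ℂ) + 1) * absTraceSq S (m + 1) g
      = ∑ x ∈ antidiagonal m, trace (hookMat x.1 x.2 (g : Matrix (Fin S) (Fin S) ℂ))
        * star (trace ((g : Matrix (Fin S) (Fin S) ℂ) ^ (m + 1))) := by
    intro g
    rw [← sum_mul, sum_antidiagonal_trace_hookMat, mul_assoc, Complex.star_def, Complex.mul_conj,
      Complex.normSq_eq_norm_sq, absTraceSq]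
  refine mul_left_cancel₀ hm ?_
  rw [← integral_const_mul]
  simp only [h]
  rw [integral_finsetSum _ fun x _ => integrable_mul_star_trace_pow (m + 1)
    (contDiff_trace (contDiff_hookMat x.1 x.2))]
  have h2 : ∀ x ∈ antidiagonal m,
      ∫ g : UGroup S, trace (hookMat x.1 x.2 (g : Matrix (Fin S) (Fin S) ℂ))
        * star (trace ((g : Matrix (Fin S) (Fin S) ℂ) ^ (m + 1))) ∂haar S
      = if x.2 < S then (m : ℂ) + 1 else 0 := by
    intro x hx
    have hx' := mem_antidiagonal.1 hx
    have h3 : ∫ g : UGroup S, trace (hookMat x.1 x.2 (g : Matrix (Fin S) (Fin S) ℂ))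
        * star (trace ((g : Matrix (Fin S) (Fin S) ℂ) ^ (m + 1))) ∂haar S
        = hookMoment S x.1 x.2 := by
      rw [hookMoment, powerMoment, hx']
    rw [h3]
    split_ifs with hxS
    · rw [hookMoment_eq _ hxS, ← hx']
      push_cast
      ring
    · exact hookMoment_eq_zero hS _ (not_lt.1 hxS)
  rw [sum_congr rfl h2, Nat.sum_antidiagonal_eq_sum_range_succ_mk,
    ← sum_range_reflect, sum_congr rfl fun i hi => by
      rw [show m - (m.succ - 1 - i) = i by have := mem_range.1 hi; omega]]
  -- After reflection the index is the leg length; the surviving hooks have leg below both `n = m +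
  -- 1` and `S`.
  have h4 : (range m.succ).filter (· < S) = range (min (m + 1) S) := by
    ext i
    simp
  rw [← sum_filter, sum_const, h4, card_range, nsmul_eq_mul, mul_comm]

end UGroup

theorem lemma9p2 (S n : ℕ) (hS : 1 ≤ S) (hn : 1 ≤ n) :
    -- `f` is continuous and conjugacy-invariant, so that its mean is defined
    Continuous (UGroup.absTraceSq S n) ∧
    (∀ g h : UGroup S, UGroup.absTraceSq S n (h * g * h⁻¹) = UGroup.absTraceSq S n g) ∧
    -- the mean exists and is unique
    (∃! F : Circle → ℂ, UGroup.IsMean (UGroup.absTraceSq S n) F) ∧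
    -- the mean is constant, equal to the Haar integral of `f`, which is `min {n, S}`
    (∀ F : Circle → ℂ, UGroup.IsMean (UGroup.absTraceSq S n) F →
      ∀ z : Circle, F z = ∫ g, UGroup.absTraceSq S n g ∂UGroup.haar S) ∧
    ∫ g, UGroup.absTraceSq S n g ∂UGroup.haar S = ((min n S : ℕ) : ℂ) := by
  have hmean := UGroup.isMean_const hS (UGroup.continuous_absTraceSq S n)
    (UGroup.absTraceSq_scalar_mul n)
  exact ⟨UGroup.continuous_absTraceSq S n, fun g h => UGroup.absTraceSq_conj n g h,
    ⟨_, hmean, fun F hF => hF.unique hS hmean⟩,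
    fun F hF z => congrFun (hF.unique hS hmean) z, UGroup.integral_absTraceSq hS hn⟩
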